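/- Let $R$ be a Gorenstein normal (noetherian, commutative) local ring with $\dim R\ge 3$; in particular $R$ is a normal domain. Let $\mathrm{Cl}(R)$ be its divisor class group, written additively; its elements are the isomorphism classes of reflexive $R$-modules of rank one, equivalently the classes of divisorial fractional ideals modulo principal ones. A finitely generated $R$-module $M$ is called maximal Cohen--Macaulay if $\operatorname{depth} M_{\mathfrak p}\ge \operatorname{height}\mathfrak p$ for all $\mathfrak p\in\operatorname{Spec}R$ (where $\operatorname{depth}0=\infty$), and a point of $\mathrm{Cl}(R)$ is called maximal Cohen--Macaulay if the reflexive module of rank one representing it is a maximal Cohen--Macaulay module. A proper ideal $\mathfrak a$ of $R$ is called Gorenstein if the ring $R/\mathfrak a$ is Gorenstein. Let $I,J$ be Gorenstein ideals of $R$ of height one, and suppose that $I$ is locally free on the punctured spectrum of $R$, that is, $I_{\mathfrak p}$ is a free $R_{\mathfrak p}$-module for every nonmaximal prime ideal $\mathfrak p$ of $R$. Such ideals $I,J$ are reflexive, and we denote their classes in $\mathrm{Cl}(R)$ again by $I,J$. (1) If the point $J+nI\in\mathrm{Cl}(R)$ is maximal Cohen--Macaulay for some integer $n\ge0$ (resp.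 $n\le0$), then so is $J+iI$ for all integers $i$ with $0\le i\le n$ (resp. $n\le i\le0$). (2) The points $J+2I$ and $J-2I$ of $\mathrm{Cl}(R)$ cannot both be maximal Cohen--Macaulay, unless $I=0$ in $\mathrm{Cl}(R)$, i.e., unless $I$ is principal. -/

import Mathlib

open scoped nonZeroDivisors

universe u

section Depth

/-- The depth of a finitely generated module `M` over a noetherian local ring `A`: the supremum of
the lengths of the sequences in the maximal ideal that are weakly `M`-regular. If `M ≠ 0`, such
sequences are `M`-regular by Nakayama's lemma; the zero module has depth `∞`. -/
noncomputable def moduleDepth (A : Type*) [CommRing A] [IsLocalRing A]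
    (M : Type*) [AddCommGroup M] [Module A M] : ℕ∞ :=
  ⨆ (rs : List A) (_ : (∀ r ∈ rs, r ∈ IsLocalRing.maximalIdeal A) ∧
    RingTheory.Sequence.IsWeaklyRegular M rs), (rs.length : ℕ∞)

/-- A finitely generated `R`-module `M` is maximal Cohen-Macaulay if
`depth M_p ≥ height p` for all prime ideals `p` of `R`. -/
def IsMaximalCohenMacaulay (R : Type*) [CommRing R]
    (M : Type*) [AddCommGroup M] [Module R M] : Prop :=
  Module.Finite R M ∧ ∀ (p : Ideal R) [p.IsPrime],
    p.height ≤ moduleDepth (Localization.AtPrime p) (LocalizedModule p.primeCompl M)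

/-- A module over a local ring is locally free on the punctured spectrum if its localization at
every nonmaximal prime ideal is free. -/
def IsLocallyFreeOnPuncturedSpectrum (R : Type*) [CommRing R] [IsLocalRing R]
    (M : Type*) [AddCommGroup M] [Module R M] : Prop :=
  ∀ (p : Ideal R) [p.IsPrime], p ≠ IsLocalRing.maximalIdeal R →
    Module.Free (Localization.AtPrime p) (LocalizedModule p.primeCompl M)

/-- A Gorenstein local ring: a noetherian local ring that has finite injective dimension as a
module over itself. -/
def IsGorensteinLocalRing (A : Type u) [CommRing A] : Prop :=
  IsNoetherianRing A ∧ IsLocalRing A ∧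
    ∃ n : ℕ, CategoryTheory.HasInjectiveDimensionLE (ModuleCat.of A A) n

/-- A (proper) ideal `I` of a local ring is Gorenstein if `R ⧸ I` is a Gorenstein (local) ring. -/
def Ideal.IsGorenstein {R : Type u} [CommRing R] (I : Ideal R) : Prop :=
  IsGorensteinLocalRing (R ⧸ I)

end Depth

section DivisorClassGroup

variable {R : Type u} [CommRing R] [IsDomain R]

/-- The divisorial (that is, reflexive) hull of a fractional ideal, where `A⁻¹ = (R : A)`. -/
noncomputable def FractionalIdeal.divHull (A : FractionalIdeal R⁰ (FractionRing R)) :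
    FractionalIdeal R⁰ (FractionRing R) := (A⁻¹)⁻¹

variable {A B : FractionalIdeal R⁰ (FractionRing R)}

theorem FractionalIdeal.mul_ne_zero_of_ne_zero (hA : A ≠ 0) (hB : B ≠ 0) : A * B ≠ 0 := by
  obtain ⟨a, ha, ha0⟩ := (Submodule.ne_bot_iff _).mp (fun h ↦ hA (coeToSubmodule_eq_bot.mp h))
  obtain ⟨b, hb, hb0⟩ := (Submodule.ne_bot_iff _).mp (fun h ↦ hB (coeToSubmodule_eq_bot.mp h))
  intro h
  have hab : a * b ∈ A * B := mul_mem_mul ha hb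
  rw [h, mem_zero_iff] at hab
  exact mul_ne_zero ha0 hb0 hab

theorem FractionalIdeal.one_ne_zero_fractionRing :
    (1 : FractionalIdeal R⁰ (FractionRing R)) ≠ 0 := fun h ↦ zero_ne_one h.symm

theorem FractionalIdeal.le_inv_iff_mul_le_one (hB : B ≠ 0) : A ≤ B⁻¹ ↔ A * B ≤ 1 :=
  FractionalIdeal.le_div_iff_mul_le hB

theorem FractionalIdeal.inv_ne_zero_of_ne_zero (hA : A ≠ 0) : A⁻¹ ≠ 0 := by
  intro h
  have := FractionalIdeal.bot_lt_mul_inv hA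
  rw [h, mul_zero] at this
  exact lt_irrefl _ this

theorem FractionalIdeal.le_divHull (hA : A ≠ 0) : A ≤ A.divHull := by
  rw [divHull, le_inv_iff_mul_le_one (inv_ne_zero_of_ne_zero hA), mul_comm,
    ← le_inv_iff_mul_le_one hA]

theorem FractionalIdeal.divHull_ne_zero (hA : A ≠ 0) : A.divHull ≠ 0 :=
  inv_ne_zero_of_ne_zero (inv_ne_zero_of_ne_zero hA)

theorem FractionalIdeal.inv_divHull (hA : A ≠ 0) : A.divHull⁻¹ = A⁻¹ :=
  le_antisymm (inv_anti_mono hA (divHull_ne_zero hA) (le_divHull hA))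
    (le_divHull (inv_ne_zero_of_ne_zero hA))

theorem FractionalIdeal.divHull_divHull (hA : A ≠ 0) : A.divHull.divHull = A.divHull := by
  rw [divHull, inv_divHull hA, divHull]

theorem FractionalIdeal.inv_divHull_mul (hA : A ≠ 0) (hB : B ≠ 0) :
    (A.divHull * B)⁻¹ = (A * B)⁻¹ := by
  refine eq_of_forall_le_iff fun C ↦ ?_
  rw [le_inv_iff_mul_le_one (mul_ne_zero_of_ne_zero (divHull_ne_zero hA) hB),
    le_inv_iff_mul_le_one (mul_ne_zero_of_ne_zero hA hB), mul_comm A.divHull, mul_comm A, ← mul_assoc,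
    ← mul_assoc, ← le_inv_iff_mul_le_one hA, ← le_inv_iff_mul_le_one (divHull_ne_zero hA),
    inv_divHull hA]

theorem FractionalIdeal.divHull_divHull_mul (hA : A ≠ 0) (hB : B ≠ 0) :
    (A.divHull * B).divHull = (A * B).divHull := by
  rw [divHull, inv_divHull_mul hA hB, divHull]

theorem FractionalIdeal.divHull_mul_divHull (hA : A ≠ 0) (hB : B ≠ 0) :
    (A * B.divHull).divHull = (A * B).divHull := by
  rw [mul_comm, divHull_divHull_mul hB hA, mul_comm]

theorem FractionalIdeal.divHull_mul_inv [IsNoetherianRing R] [IsIntegrallyClosed R]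
    (hA : A ≠ 0) : (A * A⁻¹).divHull = 1 := by
  have hA' := inv_ne_zero_of_ne_zero hA
  suffices h : (A * A⁻¹)⁻¹ = 1 by rw [divHull, h, inv_one]
  apply le_antisymm
  · intro x hx
    have h1 : spanSingleton R⁰ x * A⁻¹ ≤ A⁻¹ := by
      rw [le_inv_iff_mul_le_one hA, mul_assoc, mul_comm A⁻¹,
        ← le_inv_iff_mul_le_one (mul_ne_zero_of_ne_zero hA hA'), spanSingleton_le_iff_mem]
      exact hx
    have hfg : (A⁻¹ : FractionalIdeal R⁰ (FractionRing R)).coeToSubmodule.FG := by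
      have := FractionalIdeal.isNoetherian A⁻¹
      exact (Submodule.fg_top _).mp (this.noetherian ⊤)
    have hint : IsIntegral R x :=
      isIntegral_of_smul_mem_submodule
        (A⁻¹ : FractionalIdeal R⁰ (FractionRing R)).coeToSubmodule
        (fun h ↦ hA' (coeToSubmodule_eq_bot.mp h)) hfg x
        (fun n hn ↦ h1 (mul_mem_mul (mem_spanSingleton_self R⁰ x) hn))
    obtain ⟨r, hr⟩ := IsIntegrallyClosed.isIntegral_iff.mp hint
    exact (mem_one_iff _).mpr ⟨r, hr⟩
  · rw [le_inv_iff_mul_le_one (mul_ne_zero_of_ne_zero hA hA'), one_mul]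
    exact mul_one_div_le_one

theorem FractionalIdeal.divHull_spanSingleton (x : FractionRing R) :
    (spanSingleton R⁰ x).divHull = spanSingleton R⁰ x := by
  rw [divHull, spanSingleton_inv, spanSingleton_inv, inv_inv]

variable (R)

/-- Divisorial fractional ideals: nonzero fractional ideals `A` of `R` with `A = (R : (R : A))`.
These are the nonzero fractional ideals that are reflexive as `R`-modules. -/
def DivisorialIdeal : Type u :=
  {A : FractionalIdeal R⁰ (FractionRing R) // A ≠ 0 ∧ A.divHull = A}

variable {R}

namespace DivisorialIdeal

open FractionalIdeal

/-- The divisorial ideal generated by a nonzero fractional ideal. -/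
noncomputable def mk (A : FractionalIdeal R⁰ (FractionRing R)) (hA : A ≠ 0) : DivisorialIdeal R :=
  ⟨A.divHull, divHull_ne_zero hA, divHull_divHull hA⟩

/-- Divisorial fractional ideals of a noetherian integrally closed domain form a group: the product
of `A` and `B` is the divisorial hull of `A * B`, the inverse of `A` is `(R : A)`. -/
noncomputable instance [IsNoetherianRing R] [IsIntegrallyClosed R] :
    CommGroup (DivisorialIdeal R) where
  mul A B := mk (A.1 * B.1) (mul_ne_zero_of_ne_zero A.2.1 B.2.1)
  one := mk 1 one_ne_zero_fractionRing
  inv A := mk A.1⁻¹ (inv_ne_zero_of_ne_zero A.2.1)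
  mul_assoc A B C := Subtype.ext <| by
    change ((A.1 * B.1).divHull * C.1).divHull = (A.1 * (B.1 * C.1).divHull).divHull
    rw [divHull_divHull_mul (mul_ne_zero_of_ne_zero A.2.1 B.2.1) C.2.1,
      divHull_mul_divHull A.2.1 (mul_ne_zero_of_ne_zero B.2.1 C.2.1), mul_assoc]
  one_mul A := Subtype.ext <| by
    change ((1 : FractionalIdeal R⁰ (FractionRing R)).divHull * A.1).divHull = A.1
    rw [divHull_divHull_mul one_ne_zero_fractionRing A.2.1, one_mul, A.2.2]
  mul_one A := Subtype.ext <| by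
    change (A.1 * (1 : FractionalIdeal R⁰ (FractionRing R)).divHull).divHull = A.1
    rw [divHull_mul_divHull A.2.1 one_ne_zero_fractionRing, mul_one, A.2.2]
  mul_comm A B := Subtype.ext <| by
    change (A.1 * B.1).divHull = (B.1 * A.1).divHull
    rw [mul_comm]
  inv_mul_cancel A := Subtype.ext <| by
    change (A.1⁻¹.divHull * A.1).divHull = (1 : FractionalIdeal R⁰ (FractionRing R)).divHull
    rw [divHull_divHull_mul (inv_ne_zero_of_ne_zero A.2.1) A.2.1, mul_comm,
      divHull_mul_inv A.2.1, divHull, inv_one, inv_one]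

variable (R) in
/-- The homomorphism sending a nonzero element `x` of the fraction field to the principal
fractional ideal `R x`. -/
noncomputable def principal [IsNoetherianRing R] [IsIntegrallyClosed R] :
    (FractionRing R)ˣ →* DivisorialIdeal R where
  toFun x := ⟨spanSingleton R⁰ (x : FractionRing R), spanSingleton_ne_zero_iff.mpr x.ne_zero,
    divHull_spanSingleton _⟩
  map_one' := Subtype.ext <| by
    change spanSingleton R⁰ ((1 : (FractionRing R)ˣ) : FractionRing R) =
      (1 : FractionalIdeal R⁰ (FractionRing R)).divHull
    rw [← spanSingleton_one, divHull_spanSingleton, Units.val_one]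
  map_mul' x y := Subtype.ext <| by
    change spanSingleton R⁰ ((x * y : (FractionRing R)ˣ) : FractionRing R) =
      (spanSingleton R⁰ (x : FractionRing R) * spanSingleton R⁰ (y : FractionRing R)).divHull
    rw [spanSingleton_mul_spanSingleton, divHull_spanSingleton, Units.val_mul]

end DivisorialIdeal

variable (R) [IsNoetherianRing R] [IsIntegrallyClosed R]

/-- The divisor class group `Cl(R)` of a noetherian normal domain, written additively: divisorial
fractional ideals modulo principal ones. -/
abbrev DivisorClassGroup : Type u :=
  Additive (DivisorialIdeal R ⧸ (DivisorialIdeal.principal R).range)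

variable {R}

namespace DivisorClassGroup

/-- The class in `Cl(R)` of a divisorial fractional ideal. -/
noncomputable def mk (D : DivisorialIdeal R) : DivisorClassGroup R :=
  Additive.ofMul (QuotientGroup.mk D)

/-- The class in `Cl(R)` of a nonzero ideal `I` of `R`, that is, the class of its divisorial
hull, which is `I` itself if `I` is reflexive. -/
noncomputable def ofIdeal (I : Ideal R) (hI : I ≠ ⊥) : DivisorClassGroup R :=
  mk (DivisorialIdeal.mk (I : FractionalIdeal R⁰ (FractionRing R))
    (FractionalIdeal.coeIdeal_ne_zero.mpr hI))

/-- A point of `Cl(R)` is maximal Cohen-Macaulay if it is represented by a divisorial fractional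
ideal (equivalently, a reflexive module of rank one) that is a maximal Cohen-Macaulay module. -/
def IsMaximalCohenMacaulayPoint (c : DivisorClassGroup R) : Prop :=
  ∃ D : DivisorialIdeal R, mk D = c ∧
    IsMaximalCohenMacaulay R (D.1 : Submodule R (FractionRing R))

end DivisorClassGroup

end DivisorClassGroup

/-- An ideal of height one in a domain is nonzero. -/
theorem Ideal.ne_bot_of_height_one {R : Type u} [CommRing R] [IsDomain R] {I : Ideal R}
    (hI : I.height = 1) : I ≠ ⊥ := by
  rintro rfl
  simp at hI

/-!
Let `D` and `E` be the divisorial ideals of `I` and `J`. As `R ⧸ I` is Gorenstein of codimension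
one, `Ext¹(R ⧸ I, R)` is cyclic, so `D⁻¹` is generated by `1` and one further element `f`. For every
divisorial ideal `L` the maps `b ↦ (-f b, b)` and `(a, b) ↦ a + f b` then form an exact sequence
`0 → L * D → L × L → L * D⁻¹`, whose last map is surjective off the maximal ideal because `D` is
locally principal there.

(1) Applying `Ext(-, R)` for `L = E * D ^ k` shows that the length of `Extʲ(E * D ^ k, R)` is a
convex function of `k`; it is finite because `E` is maximal Cohen-Macaulay and `D` is locally
principal off the maximal ideal. A nonnegative convex function that vanishes at `0` and `n` vanishes
in between, and by local duality the vanishing of these groups for `j > 0` means maximal depth.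

(2) For `L = E⁻¹ * D` the module `L * D` is the dual of `E * D⁻²`, so it has depth at least three,
which forces `L × L → E⁻¹` to be surjective. Thus `E⁻¹`, a module with two generators over a local
ring, is the sum of the images `L` and `f L`, and either one of them is everything, or `b` and `f b`
generate `E⁻¹` for a single `b ∈ L`. In the first case `D` is principal. In the second `D` and `E`
are in the same class, so `D * D` is maximal Cohen-Macaulay by (1), and the same sequence for
`L = D` writes `1 ∈ R = D * D⁻¹` as `a + f b` with `a, b ∈ D`; one of `a` and `f b` is a unit of
`R`, and again `D` is principal.
-/

section ModuleExt

open CategoryTheory CategoryTheory.Abelian Pointwise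

/-- The `R`-module `Ext^n(M, N)` of two unbundled `R`-modules. -/
abbrev ModuleExt (R : Type u) [CommRing R] (M N : Type u) [AddCommGroup M] [Module R M]
    [AddCommGroup N] [Module R N] (n : ℕ) : Type u :=
  Ext.{u} (ModuleCat.of R M) (ModuleCat.of R N) n

variable {R : Type u} [CommRing R]
variable {M N X Y : Type u} [AddCommGroup M] [Module R M] [AddCommGroup N] [Module R N]
  [AddCommGroup X] [Module R X] [AddCommGroup Y] [Module R Y]

namespace ModuleExt

variable (R M N) in
/-- The identification of `Ext^0(M, N)` with `Hom(M, N)`. -/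
noncomputable def homEquiv : (M →ₗ[R] N) ≃ₗ[R] ModuleExt R M N 0 :=
  (Ext.linearEquiv₀.trans ModuleCat.homLinearEquiv).symm

section Functoriality

/-- The map `Ext^n(N, Y) → Ext^n(M, Y)` induced by `f : M → N`. -/
noncomputable def precomp (Y : Type u) [AddCommGroup Y] [Module R Y] (f : M →ₗ[R] N) (n : ℕ) :
    ModuleExt R N Y n →ₗ[R] ModuleExt R M Y n :=
  (Ext.mk₀ (ModuleCat.ofHom f)).precompOfLinear R _ (zero_add n)

/-- The map `Ext^n(X, M) → Ext^n(X, N)` induced by `f : M → N`. -/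
noncomputable def postcomp (X : Type u) [AddCommGroup X] [Module R X] (f : M →ₗ[R] N) (n : ℕ) :
    ModuleExt R X M n →ₗ[R] ModuleExt R X N n :=
  (Ext.mk₀ (ModuleCat.ofHom f)).postcompOfLinear R _ (add_zero n)

variable (n : ℕ)

theorem precomp_id : precomp Y (LinearMap.id : M →ₗ[R] M) n = LinearMap.id :=
  LinearMap.ext fun e ↦ Ext.mk₀_id_comp e

theorem precomp_comp (f : M →ₗ[R] N) (g : N →ₗ[R] X) :
    precomp Y (g ∘ₗ f) n = precomp Y f n ∘ₗ precomp Y g n :=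
  LinearMap.ext fun e ↦
    (Ext.mk₀_comp_mk₀_assoc (ModuleCat.ofHom f) (ModuleCat.ofHom g) e).symm

/-- The linear map `Hom(M, N) → Ext^n(M, Y)` pulling back a class in `Ext^n(N, Y)`. -/
noncomputable def pullback {n : ℕ} (e : ModuleExt R N Y n) :
    (M →ₗ[R] N) →ₗ[R] ModuleExt R M Y n where
  toFun f := precomp Y f n e
  map_add' f g := by
    change (Ext.mk₀ (ModuleCat.ofHom f + ModuleCat.ofHom g)).comp e (zero_add n) = _
    rw [Ext.mk₀_add, Ext.add_comp]
    rfl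
  map_smul' r f := by
    change (Ext.mk₀ (r • ModuleCat.ofHom f)).comp e (zero_add n) = _
    rw [Ext.mk₀_smul, Ext.smul_comp]
    rfl

theorem precomp_smul (r : R) (f : M →ₗ[R] N) : precomp Y (r • f) n = r • precomp Y f n :=
  LinearMap.ext fun e ↦ map_smul (pullback e) r f

theorem precomp_zero : precomp Y (0 : M →ₗ[R] N) n = 0 :=
  LinearMap.ext fun e ↦ map_zero (pullback e)

theorem precomp_lsmul (r : R) (e : ModuleExt R M Y n) :
    precomp Y (LinearMap.lsmul R M r) n e = r • e := by
  rw [show LinearMap.lsmul R M r = r • LinearMap.id from rfl, precomp_smul, precomp_id]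
  rfl

theorem postcomp_lsmul (r : R) (e : ModuleExt R X M n) :
    postcomp X (LinearMap.lsmul R M r) n e = r • e :=
  (Ext.smul_eq_comp_mk₀ e r).symm

theorem precomp_homEquiv (f : X →ₗ[R] M) (g : M →ₗ[R] N) :
    precomp N f 0 (homEquiv R M N g) = homEquiv R X N (g ∘ₗ f) :=
  Ext.mk₀_comp_mk₀ _ _

theorem postcomp_homEquiv (f : X →ₗ[R] M) (g : M →ₗ[R] N) :
    postcomp X g 0 (homEquiv R X M f) = homEquiv R X N (g ∘ₗ f) :=
  Ext.mk₀_comp_mk₀ _ _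

theorem annihilator_le_annihilator :
    Module.annihilator R M ≤ Module.annihilator R (ModuleExt R M Y n) := by
  refine fun r hr ↦ Module.mem_annihilator.mpr fun e ↦ ?_
  have hzero : LinearMap.lsmul R M r = 0 := LinearMap.ext (Module.mem_annihilator.mp hr)
  rw [← precomp_lsmul, hzero, precomp_zero, LinearMap.zero_apply]

variable (Y) in
/-- An isomorphism `M ≃ N` induces `Ext^n(N, Y) ≃ Ext^n(M, Y)`. -/
noncomputable def precompEquiv (e : M ≃ₗ[R] N) : ModuleExt R N Y n ≃ₗ[R] ModuleExt R M Y n :=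
  LinearEquiv.ofLinearMap (precomp Y e.toLinearMap n) (precomp Y e.symm.toLinearMap n)
    (by rw [← precomp_comp, LinearEquiv.symm_comp, precomp_id])
    (by rw [← precomp_comp, LinearEquiv.comp_symm, precomp_id])

theorem subsingleton_congr_left (e : M ≃ₗ[R] N) :
    Subsingleton (ModuleExt R M Y n) ↔ Subsingleton (ModuleExt R N Y n) :=
  (precompEquiv Y n e).symm.toEquiv.subsingleton_congr

theorem subsingleton_of_subsingleton_left [Subsingleton M] :
    Subsingleton (ModuleExt R M Y n) :=
  subsingleton_of_forall_eq 0 fun e ↦ by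
    rw [← one_smul R e]
    exact Module.mem_annihilator.mp (annihilator_le_annihilator n
      (Module.mem_annihilator.mpr fun _ ↦ Subsingleton.elim _ _)) e

theorem prod_precomp_inl_inr_surjective :
    Function.Surjective
      ((precomp Y (LinearMap.inl R M N) n).prod (precomp Y (LinearMap.inr R M N) n)) := by
  rintro ⟨a, b⟩
  refine ⟨precomp Y (LinearMap.fst R M N) n a + precomp Y (LinearMap.snd R M N) n b, ?_⟩
  refine Prod.ext (?_ : precomp Y (LinearMap.inl R M N) n _ = a)
    (?_ : precomp Y (LinearMap.inr R M N) n _ = b) <;>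
  simp only [map_add, ← LinearMap.comp_apply, ← precomp_comp, LinearMap.fst_comp_inl,
    LinearMap.fst_comp_inr, LinearMap.snd_comp_inl, LinearMap.snd_comp_inr, precomp_id,
    precomp_zero, LinearMap.id_apply, LinearMap.zero_apply, add_zero, zero_add]

theorem postcomp_zero_injective {f : M →ₗ[R] N} (hf : Function.Injective f) :
    Function.Injective (postcomp X f 0) := by
  refine (injective_iff_map_eq_zero _).mpr fun e he ↦ ?_
  obtain ⟨φ, rfl⟩ := (homEquiv R X M).surjective e
  rw [postcomp_homEquiv, LinearEquiv.map_eq_zero_iff] at he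
  rw [LinearEquiv.map_eq_zero_iff]
  exact LinearMap.ext fun x ↦ hf (by simpa using LinearMap.congr_fun he x)

end Functoriality

end ModuleExt

theorem surjective_of_exact_of_subsingleton {f : M →ₗ[R] N} {g : N →ₗ[R] X}
    (h : Function.Exact f g) (hX : Subsingleton X) : Function.Surjective f :=
  fun y ↦ (h y).mp (hX.elim _ _)

theorem injective_of_exact_of_subsingleton {f : M →ₗ[R] N} {g : N →ₗ[R] X}
    (h : Function.Exact f g) (hM : Subsingleton M) : Function.Injective g :=
  (injective_iff_map_eq_zero _).mpr fun y hy ↦ by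
    obtain ⟨x, rfl⟩ := (h y).mp hy
    rw [hM.elim x 0, map_zero]

theorem subsingleton_of_exact {f : M →ₗ[R] N} {g : N →ₗ[R] X} (h : Function.Exact f g)
    (hM : Subsingleton M) (hX : Subsingleton X) : Subsingleton N :=
  ⟨fun _ _ ↦ injective_of_exact_of_subsingleton h hM (hX.elim _ _)⟩

/-- The linear maps `f` and `g` form a short exact sequence `0 → M → N → X → 0`; an unbundled
form of `CategoryTheory.ShortComplex.ShortExact`. -/
structure IsShortExact (f : M →ₗ[R] N) (g : N →ₗ[R] X) : Prop where
  injective : Function.Injective f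
  exact : Function.Exact f g
  surjective : Function.Surjective g

namespace IsShortExact

theorem subtype_mkQ (P : Submodule R M) : IsShortExact P.subtype P.mkQ :=
  ⟨P.injective_subtype, LinearMap.exact_subtype_mkQ P, P.mkQ_surjective⟩

theorem mkQ_range {f : M →ₗ[R] N} (hf : Function.Injective f) :
    IsShortExact f (LinearMap.range f).mkQ :=
  ⟨hf, LinearMap.exact_map_mkQ_range f, Submodule.mkQ_surjective _⟩

theorem subtype_ker {f : M →ₗ[R] N} (hf : Function.Surjective f) :
    IsShortExact (LinearMap.ker f).subtype f :=
  ⟨Submodule.injective_subtype _, LinearMap.exact_subtype_ker_map f, hf⟩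

theorem rangeRestrict {f : M →ₗ[R] N} {g : N →ₗ[R] X} (hf : Function.Injective f)
    (h : Function.Exact f g) : IsShortExact f g.rangeRestrict :=
  ⟨hf, fun y ↦ by rw [← h y, ← Submodule.coe_eq_zero]; rfl,
    g.surjective_rangeRestrict⟩

theorem lsmul_mkQ {r : R} (hr : IsSMulRegular M r) :
    IsShortExact (LinearMap.lsmul R M r) (r • (⊤ : Submodule R M)).mkQ :=
  ⟨hr, LinearMap.exact_lsmul_mkQ_smul_top M r, Submodule.mkQ_surjective _⟩

theorem inl_snd : IsShortExact (LinearMap.inl R M N) (LinearMap.snd R M N) :=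
  ⟨LinearMap.inl_injective, Function.Exact.inl_snd, LinearMap.snd_surjective⟩

variable {f : M →ₗ[R] N} {g : N →ₗ[R] X}

theorem shortExact (h : IsShortExact f g) :
    (ModuleCat.shortComplexOfCompEqZero f g h.exact.linearMap_comp_eq_zero).ShortExact :=
  ModuleCat.shortComplex_shortExact _ h.exact h.injective h.surjective

/-- The class in `Ext^1(X, M)` of the short exact sequence `0 → M → N → X → 0`. -/
noncomputable def extClass (h : IsShortExact f g) : ModuleExt R X M 1 :=
  h.shortExact.extClass

section LongExactSequences

variable (h : IsShortExact f g) (T : Type u) [AddCommGroup T] [Module R T] (n : ℕ)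

/-- The connecting map `Ext^n(M, T) → Ext^(1+n)(X, T)`. -/
noncomputable def precompConnecting : ModuleExt R M T n →ₗ[R] ModuleExt R X T (1 + n) :=
  h.extClass.precompOfLinear R _ rfl

/-- The connecting map `Ext^n(T, X) → Ext^(n+1)(T, M)`. -/
noncomputable def postcompConnecting : ModuleExt R T X n →ₗ[R] ModuleExt R T M (n + 1) :=
  h.extClass.postcompOfLinear R _ rfl

open ModuleExt

theorem postcompConnecting_precomp {T' : Type u} [AddCommGroup T'] [Module R T']
    (φ : T' →ₗ[R] T) (e : ModuleExt R T X n) :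
    h.postcompConnecting T' n (precomp X φ n e) =
      precomp M φ (n + 1) (h.postcompConnecting T n e) :=
  Ext.comp_assoc (Ext.mk₀ (ModuleCat.ofHom φ)) e h.extClass (zero_add n) rfl (by omega)

include h

theorem exact_precomp : Function.Exact (precomp T g n) (precomp T f n) :=
  (ShortComplex.ab_exact_iff_function_exact _).mp
    (Ext.contravariant_sequence_exact₂' h.shortExact (ModuleCat.of R T) n)

theorem exact_precomp_connecting : Function.Exact (precomp T f n) (h.precompConnecting T n) :=
  (ShortComplex.ab_exact_iff_function_exact _).mp
    (Ext.contravariant_sequence_exact₁' h.shortExact (ModuleCat.of R T) n (1 + n) rfl)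

theorem exact_connecting_precomp :
    Function.Exact (h.precompConnecting T n) (precomp T g (1 + n)) :=
  (ShortComplex.ab_exact_iff_function_exact _).mp
    (Ext.contravariant_sequence_exact₃' h.shortExact (ModuleCat.of R T) n (1 + n) rfl)

theorem exact_postcomp : Function.Exact (postcomp T f n) (postcomp T g n) :=
  (ShortComplex.ab_exact_iff_function_exact _).mp
    (Ext.covariant_sequence_exact₂' (ModuleCat.of R T) h.shortExact n)

theorem exact_postcomp_connecting : Function.Exact (postcomp T g n) (h.postcompConnecting T n) :=
  (ShortComplex.ab_exact_iff_function_exact _).mp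
    (Ext.covariant_sequence_exact₃' (ModuleCat.of R T) h.shortExact n (n + 1) rfl)

theorem exact_connecting_postcomp :
    Function.Exact (h.postcompConnecting T n) (postcomp T f (n + 1)) :=
  (ShortComplex.ab_exact_iff_function_exact _).mp
    (Ext.covariant_sequence_exact₁' (ModuleCat.of R T) h.shortExact n (n + 1) rfl)

theorem precomp_surjective (hX : Subsingleton (ModuleExt R X T (n + 1))) :
    Function.Surjective (precomp T f n) := by
  rw [add_comm] at hX
  exact surjective_of_exact_of_subsingleton (h.exact_precomp_connecting T n) hX

theorem precomp_injective (hM : Subsingleton (ModuleExt R M T n)) :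
    Function.Injective (precomp T g (n + 1)) := by
  rw [add_comm]
  exact injective_of_exact_of_subsingleton (h.exact_connecting_precomp T n) hM

theorem postcomp_injective (hX : Subsingleton (ModuleExt R T X n)) :
    Function.Injective (postcomp T f (n + 1)) :=
  injective_of_exact_of_subsingleton (h.exact_connecting_postcomp T n) hX

theorem subsingleton_ext_middle (hM : Subsingleton (ModuleExt R M T n))
    (hX : Subsingleton (ModuleExt R X T n)) : Subsingleton (ModuleExt R N T n) :=
  subsingleton_of_exact (h.exact_precomp T n) hX hM

theorem subsingleton_ext_left (hN : Subsingleton (ModuleExt R N T n))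
    (hX : Subsingleton (ModuleExt R X T (n + 1))) : Subsingleton (ModuleExt R M T n) :=
  subsingleton_of_exact (h.exact_precomp_connecting T n) hN (add_comm n 1 ▸ hX)

theorem subsingleton_ext_right (hM : Subsingleton (ModuleExt R M T n))
    (hN : Subsingleton (ModuleExt R N T (n + 1))) : Subsingleton (ModuleExt R X T (n + 1)) :=
  ⟨fun _ _ ↦ h.precomp_injective T n hM (hN.elim _ _)⟩

theorem subsingleton_ext_to_middle (hM : Subsingleton (ModuleExt R T M n))
    (hX : Subsingleton (ModuleExt R T X n)) : Subsingleton (ModuleExt R T N n) :=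
  subsingleton_of_exact (h.exact_postcomp T n) hM hX

theorem subsingleton_ext_to_left (hX : Subsingleton (ModuleExt R T X n))
    (hN : Subsingleton (ModuleExt R T N (n + 1))) : Subsingleton (ModuleExt R T M (n + 1)) :=
  subsingleton_of_exact (h.exact_connecting_postcomp T n) hX hN

theorem subsingleton_ext_to_right (hN : Subsingleton (ModuleExt R T N n))
    (hM : Subsingleton (ModuleExt R T M (n + 1))) : Subsingleton (ModuleExt R T X n) :=
  subsingleton_of_exact (h.exact_postcomp_connecting T n) hN hM

end LongExactSequences

end IsShortExact

/-- `Y` behaves as an injective module with respect to `M`: the higher `Ext^j(M, Y)` vanish. -/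
def HasNoHigherExt (R : Type u) [CommRing R] (M Y : Type u) [AddCommGroup M] [Module R M]
    [AddCommGroup Y] [Module R Y] : Prop :=
  ∀ j, 0 < j → Subsingleton (ModuleExt R M Y j)

theorem HasNoHigherExt.of_free [Module.Free R M] : HasNoHigherExt R M Y := by
  intro j hj
  obtain ⟨j, rfl⟩ := Nat.exists_eq_succ_of_ne_zero hj.ne'
  have : Projective (ModuleCat.of R M) := ModuleCat.projective_of_free (Module.Free.chooseBasis R M)
  exact Ext.subsingleton_of_projective _ _ _

end ModuleExt

section RegularSequences

open RingTheory.Sequence IsLocalRing ModuleExt Pointwise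

variable {R : Type u} [CommRing R]

section Nakayama

variable [IsLocalRing R] {M : Type u} [AddCommGroup M] [Module R M] [Module.Finite R M]

theorem subsingleton_of_lsmul_surjective {x : R} (hx : x ∈ maximalIdeal R)
    (h : Function.Surjective (LinearMap.lsmul R M x)) : Subsingleton M := by
  rw [← Submodule.subsingleton_iff R, ← subsingleton_iff_bot_eq_top, eq_comm]
  refine Submodule.eq_bot_of_le_smul_of_le_jacobson_bot (maximalIdeal R) ⊤
    Module.Finite.fg_top (fun m _ ↦ ?_) (maximalIdeal_le_jacobson _)
  obtain ⟨m, rfl⟩ := h m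
  exact Submodule.smul_mem_smul hx trivial

theorem isPrincipal_top_of_exact {N : Type u} [AddCommGroup N] [Module R N] {x : R}
    (hx : x ∈ maximalIdeal R) {δ : M →ₗ[R] N} (h : Function.Exact (LinearMap.lsmul R M x) δ)
    (hδ : Function.Surjective δ) (hN : (⊤ : Submodule R N).IsPrincipal) :
    (⊤ : Submodule R M).IsPrincipal := by
  obtain ⟨b, hb⟩ := hN.principal
  obtain ⟨a, rfl⟩ := hδ b
  refine ⟨a, le_antisymm (Submodule.le_of_le_smul_of_le_jacobson_bot Module.Finite.fg_top
    (maximalIdeal_le_jacobson ⊥) fun y _ ↦ ?_) le_top⟩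
  obtain ⟨r, hr⟩ := Submodule.mem_span_singleton.mp (hb ▸ Submodule.mem_top : δ y ∈ _)
  obtain ⟨z, hz⟩ := (h (y - r • a)).mp (by rw [map_sub, map_smul, hr, sub_self])
  rw [← sub_add_cancel y (r • a), ← hz]
  exact add_mem (Submodule.mem_sup_right (Submodule.smul_mem_smul hx trivial))
    (Submodule.mem_sup_left (Submodule.smul_mem _ _ (Submodule.mem_span_singleton_self _)))

end Nakayama

theorem isPrincipal_top_congr {M N : Type u} [AddCommGroup M] [Module R M] [AddCommGroup N]
    [Module R N] (e : M ≃ₗ[R] N) (h : (⊤ : Submodule R M).IsPrincipal) :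
    (⊤ : Submodule R N).IsPrincipal := by
  rw [← LinearEquiv.range e, LinearMap.range_eq_map]
  exact h.map e.toLinearMap

section Quotients

variable {N Y : Type u} [AddCommGroup N] [Module R N] [AddCommGroup Y] [Module R Y]

theorem exact_precomp_lsmul_connecting {x : R} (hx : IsSMulRegular N x) (n : ℕ) :
    Function.Exact (LinearMap.lsmul R (ModuleExt R N Y n) x)
      ((IsShortExact.lsmul_mkQ hx).precompConnecting Y n) := by
  rw [← show precomp Y (LinearMap.lsmul R N x) n = LinearMap.lsmul R _ x from
    LinearMap.ext (precomp_lsmul n x)]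
  exact (IsShortExact.lsmul_mkQ hx).exact_precomp_connecting Y n

/-- The quotient of `N` by the empty sequence is `N`. -/
noncomputable def quotientOfListNilEquiv (N : Type u) [AddCommGroup N] [Module R N] :
    (N ⧸ (Ideal.ofList ([] : List R) • ⊤ : Submodule R N)) ≃ₗ[R] N :=
  Submodule.quotEquivOfEqBot _ (by rw [Ideal.ofList_nil, Submodule.bot_smul])

theorem subsingleton_ext_quotient_of_isWeaklyRegular (a : ℕ) {rs : List R}
    (hreg : IsWeaklyRegular N rs) (hN : ∀ j, a < j → Subsingleton (ModuleExt R N Y j)) (j : ℕ)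
    (hj : a + rs.length < j) :
    Subsingleton (ModuleExt R (N ⧸ (Ideal.ofList rs • ⊤ : Submodule R N)) Y j) := by
  induction rs generalizing N a with
  | nil => exact (subsingleton_congr_left j (quotientOfListNilEquiv N)).mpr (hN j hj)
  | cons x rs ih =>
    rw [isWeaklyRegular_cons_iff] at hreg
    rw [List.length_cons] at hj
    refine (subsingleton_congr_left j
      (Submodule.quotOfListConsSMulTopEquivQuotSMulTopInner N x rs)).mpr
        (ih (a + 1) hreg.2 (fun i hi ↦ ?_) (by omega))
    obtain ⟨i, rfl⟩ := Nat.exists_eq_succ_of_ne_zero (Nat.ne_zero_of_lt hi)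
    exact (IsShortExact.lsmul_mkQ hreg.1).subsingleton_ext_right Y i (hN i (by omega))
      (hN (i + 1) (by omega))

variable [IsNoetherianRing R] [IsLocalRing R] [Module.Finite R N] [Module.Finite R Y]

theorem subsingleton_ext_of_quotient {rs : List R} (hrs : ∀ r ∈ rs, r ∈ maximalIdeal R)
    (hreg : IsWeaklyRegular N rs) (j : ℕ)
    (h : Subsingleton
      (ModuleExt R (N ⧸ (Ideal.ofList rs • ⊤ : Submodule R N)) Y (j + rs.length))) :
    Subsingleton (ModuleExt R N Y j) := by
  induction rs generalizing N j with
  | nil => exact (subsingleton_congr_left j (quotientOfListNilEquiv N)).mp h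
  | cons x rs ih =>
    rw [isWeaklyRegular_cons_iff] at hreg
    rw [List.forall_mem_cons] at hrs
    rw [List.length_cons, add_comm rs.length, ← add_assoc, subsingleton_congr_left _
      (Submodule.quotOfListConsSMulTopEquivQuotSMulTopInner N x rs)] at h
    have hquot : Subsingleton (ModuleExt R (QuotSMulTop x N) Y (1 + j)) :=
      add_comm j 1 ▸ ih hrs.2 hreg.2 (j + 1) h
    exact subsingleton_of_lsmul_surjective hrs.1
      (surjective_of_exact_of_subsingleton (exact_precomp_lsmul_connecting hreg.1 j) hquot)

theorem isPrincipal_ext_of_quotient {rs : List R} (hrs : ∀ r ∈ rs, r ∈ maximalIdeal R)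
    (hreg : IsWeaklyRegular N rs) (j : ℕ)
    (hsucc : Subsingleton
      (ModuleExt R (N ⧸ (Ideal.ofList rs • ⊤ : Submodule R N)) Y (j + 1 + rs.length)))
    (h : (⊤ : Submodule R (ModuleExt R (N ⧸ (Ideal.ofList rs • ⊤ : Submodule R N)) Y
      (j + rs.length))).IsPrincipal) :
    (⊤ : Submodule R (ModuleExt R N Y j)).IsPrincipal := by
  induction rs generalizing N j with
  | nil => exact isPrincipal_top_congr (precompEquiv Y j (quotientOfListNilEquiv N).symm) h
  | cons x rs ih =>
    have hN := subsingleton_ext_of_quotient hrs hreg (j + 1) hsucc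
    rw [isWeaklyRegular_cons_iff] at hreg
    rw [List.forall_mem_cons] at hrs
    let E := Submodule.quotOfListConsSMulTopEquivQuotSMulTopInner N x rs
    rw [List.length_cons, add_comm rs.length, ← add_assoc] at h hsucc
    have hquot : (⊤ : Submodule R (ModuleExt R (QuotSMulTop x N) Y (1 + j))).IsPrincipal :=
      add_comm j 1 ▸ ih hrs.2 hreg.2 (j + 1) ((subsingleton_congr_left _ E).mp hsucc)
        (isPrincipal_top_congr (precompEquiv Y _ E.symm) h)
    refine isPrincipal_top_of_exact hrs.1 (exact_precomp_lsmul_connecting hreg.1 j) ?_ hquot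
    exact surjective_of_exact_of_subsingleton
      ((IsShortExact.lsmul_mkQ hreg.1).exact_connecting_precomp Y j) (add_comm j 1 ▸ hN)

end Quotients

section Rees

variable {M N : Type u} [AddCommGroup M] [Module R M] [AddCommGroup N] [Module R N]

theorem postcomp_lsmul_eq_zero {x : R} (hx : x ∈ Module.annihilator R N) (n : ℕ) :
    postcomp N (LinearMap.lsmul R M x) n = 0 :=
  LinearMap.ext fun e ↦ (postcomp_lsmul n x e).trans
    (Module.mem_annihilator.mp (annihilator_le_annihilator n hx) e)

theorem subsingleton_ext_of_lt_length {rs : List R} (hreg : IsWeaklyRegular M rs)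
    (hN : ∀ r ∈ rs, r ∈ Module.annihilator R N) (i : ℕ) (hi : i < rs.length) :
    Subsingleton (ModuleExt R N M i) := by
  induction rs generalizing M i with
  | nil => simp at hi
  | cons x rs ih =>
    rw [isWeaklyRegular_cons_iff] at hreg
    rw [List.forall_mem_cons] at hN
    have hinj : Function.Injective (postcomp N (LinearMap.lsmul R M x) i) := by
      cases i with
      | zero => exact postcomp_zero_injective hreg.1
      | succ i =>
        exact (IsShortExact.lsmul_mkQ hreg.1).postcomp_injective N i
          (ih hreg.2 hN.2 i (by simpa using hi))
    refine subsingleton_of_forall_eq 0 fun e ↦ hinj ?_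
    rw [postcomp_lsmul_eq_zero hN.1, LinearMap.zero_apply, LinearMap.zero_apply]

theorem bijective_postcompConnecting {x : R} (hx : IsSMulRegular M x)
    (hN : x ∈ Module.annihilator R N) (n : ℕ) (h : Subsingleton (ModuleExt R N M n)) :
    Function.Bijective ((IsShortExact.lsmul_mkQ hx).postcompConnecting N n) :=
  ⟨injective_of_exact_of_subsingleton
      ((IsShortExact.lsmul_mkQ hx).exact_postcomp_connecting N n) h,
    fun e ↦ ((IsShortExact.lsmul_mkQ hx).exact_connecting_postcomp N n e).mp
      (by rw [postcomp_lsmul_eq_zero hN, LinearMap.zero_apply])⟩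

/-- The class in `Ext^r(M / rs M, M)` attached to a weakly `M`-regular sequence `rs` of length
`r`: the Yoneda product of the classes of the extensions given by the successive elements. -/
noncomputable def reesClass : (rs : List R) → (M : Type u) → [AddCommGroup M] → [Module R M] →
    IsWeaklyRegular M rs → ModuleExt R (M ⧸ (Ideal.ofList rs • ⊤ : Submodule R M)) M rs.length
  | [], M, _, _, _ => homEquiv R _ M (quotientOfListNilEquiv M).toLinearMap
  | x :: rs, M, _, _, hreg =>
    have hreg := (isWeaklyRegular_cons_iff M x rs).mp hreg
    precomp M (Submodule.quotOfListConsSMulTopEquivQuotSMulTopInner M x rs).toLinearMap _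
      ((IsShortExact.lsmul_mkQ hreg.1).postcompConnecting _ rs.length (reesClass rs _ hreg.2))

theorem bijective_pullback_reesClass {rs : List R} (hreg : IsWeaklyRegular M rs)
    (hN : ∀ r ∈ rs, r ∈ Module.annihilator R N) :
    Function.Bijective (pullback (M := N) (reesClass rs M hreg)) := by
  induction rs generalizing M with
  | nil =>
    have hcomp : ⇑(pullback (M := N) (reesClass [] M hreg)) =
        homEquiv R N M ∘ (quotientOfListNilEquiv M).congrRight :=
      funext fun φ ↦ precomp_homEquiv φ (quotientOfListNilEquiv M).toLinearMap
    rw [hcomp]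
    exact (homEquiv R N M).bijective.comp (LinearEquiv.bijective _)
  | cons x rs ih =>
    have hvanish := subsingleton_ext_of_lt_length hreg hN rs.length (Nat.lt_succ_self _)
    have hreg' := (isWeaklyRegular_cons_iff M x rs).mp hreg
    rw [List.forall_mem_cons] at hN
    let E := Submodule.quotOfListConsSMulTopEquivQuotSMulTopInner M x rs
    let δ := (IsShortExact.lsmul_mkQ hreg'.1).postcompConnecting N rs.length
    have hcomp : ⇑(pullback (M := N) (reesClass (x :: rs) M hreg)) =
        δ ∘ pullback (reesClass rs _ hreg'.2) ∘ E.congrRight := by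
      funext φ
      refine (LinearMap.congr_fun (precomp_comp _ φ E.toLinearMap) _).symm.trans ?_
      exact ((IsShortExact.lsmul_mkQ hreg'.1).postcompConnecting_precomp _ _ _ _).symm
    rw [hcomp]
    exact (bijective_postcompConnecting hreg'.1 hN.1 _ hvanish).comp
      ((ih hreg'.2 hN.2).comp (LinearEquiv.bijective _))

/-- Rees' isomorphism `Hom(N, M / rs M) ≃ Ext^r(N, M)` for a weakly `M`-regular sequence `rs` of
length `r` that kills `N`. -/
noncomputable def reesEquiv {rs : List R} (hreg : IsWeaklyRegular M rs)
    (hN : ∀ r ∈ rs, r ∈ Module.annihilator R N) :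
    (N →ₗ[R] M ⧸ (Ideal.ofList rs • ⊤ : Submodule R M)) ≃ₗ[R] ModuleExt R N M rs.length :=
  LinearEquiv.ofBijective (pullback (reesClass rs M hreg)) (bijective_pullback_reesClass hreg hN)

theorem reesEquiv_comp {N' : Type u} [AddCommGroup N'] [Module R N'] {rs : List R}
    (hreg : IsWeaklyRegular M rs) (hN : ∀ r ∈ rs, r ∈ Module.annihilator R N)
    (hN' : ∀ r ∈ rs, r ∈ Module.annihilator R N') (f : N' →ₗ[R] N)
    (φ : N →ₗ[R] M ⧸ (Ideal.ofList rs • ⊤ : Submodule R M)) :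
    reesEquiv hreg hN' (φ ∘ₗ f) = precomp M f _ (reesEquiv hreg hN φ) :=
  LinearMap.congr_fun (precomp_comp _ f φ) _

end Rees

section Existence

variable {M : Type u} [AddCommGroup M] [Module R M]

theorem isWeaklyRegular_of_subsingleton [Subsingleton M] (rs : List R) : IsWeaklyRegular M rs := by
  induction rs generalizing M with
  | nil => exact IsWeaklyRegular.nil R M
  | cons x rs ih =>
    exact (isWeaklyRegular_cons_iff M x rs).mpr ⟨Function.injective_of_subsingleton _, ih⟩

theorem support_residueField_eq_zeroLocus [IsLocalRing R] {I : Ideal R}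
    (hI : maximalIdeal R ≤ I.radical) :
    Module.support R (R ⧸ maximalIdeal R) =
      PrimeSpectrum.zeroLocus ((maximalIdeal R ⊓ I : Ideal R) : Set R) := by
  rw [Module.support_eq_zeroLocus, Ideal.annihilator_quotient,
    ← PrimeSpectrum.zeroLocus_radical (maximalIdeal R ⊓ I), Ideal.radical_inf,
    (maximalIdeal.isMaximal R).isPrime.radical, inf_eq_left.mpr hI]

theorem exists_isWeaklyRegular_of_subsingleton_ext [IsNoetherianRing R] [IsLocalRing R]
    [Module.Finite R M] {I : Ideal R} (hI : maximalIdeal R ≤ I.radical)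
    (n : ℕ) (h : ∀ i < n, Subsingleton (ModuleExt R (R ⧸ maximalIdeal R) M i)) :
    ∃ rs : List R, rs.length = n ∧ (∀ r ∈ rs, r ∈ maximalIdeal R ⊓ I) ∧ IsWeaklyRegular M rs := by
  rcases subsingleton_or_nontrivial M with hM | hM
  · exact ⟨List.replicate n 0, List.length_replicate,
      fun r hr ↦ List.eq_of_mem_replicate hr ▸ zero_mem _, isWeaklyRegular_of_subsingleton _⟩
  have hlt : (maximalIdeal R ⊓ I) • (⊤ : Submodule R M) < ⊤ :=
    (Submodule.smul_mono_left inf_le_left).trans_lt (lt_top_iff_ne_top.mpr fun htop ↦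
      bot_ne_top (Submodule.eq_bot_of_le_smul_of_le_jacobson_bot (maximalIdeal R)
        (⊤ : Submodule R M) Module.Finite.fg_top htop.ge (maximalIdeal_le_jacobson _)).symm)
  obtain ⟨rs, hlen, hmem, hreg⟩ := ModuleCat.exists_isRegular_of_exists_subsingleton_ext
    (maximalIdeal R ⊓ I) n (ModuleCat.of R M) hlt (ModuleCat.of R (R ⧸ maximalIdeal R))
    (support_residueField_eq_zeroLocus hI) h
  exact ⟨rs, hlen, hmem, hreg.toIsWeaklyRegular⟩

end Existence

end RegularSequences

section ResidueField

open IsLocalRing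

variable {R : Type u} [CommRing R] [IsLocalRing R]

theorem injective_of_ne_zero_of_residueField {N : Type*} [AddCommGroup N] [Module R N]
    {φ : (R ⧸ maximalIdeal R) →ₗ[R] N} (h : φ ≠ 0) : Function.Injective φ := by
  have : IsSimpleModule R (R ⧸ maximalIdeal R) :=
    isSimpleModule_iff_isCoatom.mpr (maximalIdeal.isMaximal R).out
  exact LinearMap.injective_of_ne_zero h

theorem exists_injective_of_residueField {N : Type*} [AddCommGroup N] [Module R N] {a : N}
    (ha0 : a ≠ 0) (ha : ∀ r ∈ maximalIdeal R, r • a = 0) :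
    ∃ φ : (R ⧸ maximalIdeal R) →ₗ[R] N,
      Function.Injective φ ∧ φ ((maximalIdeal R).mkQ 1) = a := by
  let φ := (maximalIdeal R).liftQ (LinearMap.toSpanSingleton R N a) ha
  have hφ : φ ((maximalIdeal R).mkQ 1) = a := one_smul R a
  exact ⟨φ, injective_of_ne_zero_of_residueField fun h ↦
    ha0 (by rw [← hφ, h, LinearMap.zero_apply]), hφ⟩

theorem exists_socle_element [IsNoetherianRing R] (N : Type*) [AddCommGroup N] [Module R N]
    [Nontrivial N] (hN : maximalIdeal R ≤ (Module.annihilator R N).radical) :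
    ∃ a : N, a ≠ 0 ∧ ∀ r ∈ maximalIdeal R, r • a = 0 := by
  obtain ⟨p, hp⟩ := associatedPrimes.nonempty R N
  obtain ⟨hprime, a, ha⟩ := isAssociatedPrime_iff.mp hp
  have hmem (r : R) : r ∈ p ↔ r • a = 0 := by
    rw [ha, Submodule.mem_colon_singleton, Submodule.mem_bot]
  have hle : maximalIdeal R ≤ p := hN.trans <| hprime.radical_le_iff.mpr fun r hr ↦
    (hmem r).mpr (Module.mem_annihilator.mp hr a)
  refine ⟨a, fun h0 ↦ hprime.ne_top ((Ideal.eq_top_iff_one p).mpr ?_), fun r hr ↦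
    (hmem r).mp (hle hr)⟩
  rw [hmem, h0, smul_zero]

/-- The socle of `N` (the elements killed by the maximal ideal) is zero or one-dimensional over
the residue field. -/
def HasCyclicSocle (R N : Type*) [CommRing R] [IsLocalRing R] [AddCommGroup N] [Module R N] :
    Prop :=
  ∀ a b : N, (∀ r ∈ maximalIdeal R, r • a = 0) → (∀ r ∈ maximalIdeal R, r • b = 0) → a ≠ 0 →
    ∃ c : R, c • a = b

omit [IsLocalRing R] in
theorem exists_eq_smul_id_of_quotient {P : Submodule R R} (θ : (R ⧸ P) →ₗ[R] R ⧸ P) :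
    ∃ c : R, θ = c • LinearMap.id := by
  obtain ⟨c, hc⟩ := P.mkQ_surjective (θ (P.mkQ 1))
  refine ⟨c, Submodule.linearMap_qext _ (LinearMap.ext_ring ?_)⟩
  rw [LinearMap.comp_apply, ← hc, LinearMap.comp_apply, LinearMap.smul_apply, LinearMap.id_apply,
    ← map_smul, smul_eq_mul, mul_one]

theorem maximalIdeal_le_radical_of_forall_isPrime {I : Ideal R}
    (h : ∀ p : Ideal R, p.IsPrime → I ≤ p → p = maximalIdeal R) :
    maximalIdeal R ≤ I.radical := by
  rw [Ideal.radical_eq_sInf]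
  exact le_sInf fun p hp ↦ (h p hp.2 hp.1).ge

theorem ringKrullDim_quotient_eq_zero {I : Ideal R} (hle : I ≤ maximalIdeal R)
    (hI : maximalIdeal R ≤ I.radical) : ringKrullDim (R ⧸ I) = 0 := by
  rw [ringKrullDim_quotient, ← PrimeSpectrum.zeroLocus_radical,
    le_antisymm ((maximalIdeal.isMaximal R).isPrime.radical_le_iff.mpr hle) hI,
    PrimeSpectrum.zeroLocus_eq_singleton]
  exact Order.krullDim_eq_zero_of_unique

end ResidueField

section ExtVanishing

open RingTheory.Sequence IsLocalRing

variable {R : Type u} [CommRing R]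

/-- `Ext^j(N, Y) = 0` for all finitely generated `N` and all `j ≥ t`; over a noetherian ring this
says that the injective dimension of `Y` is less than `t`. -/
def ExtVanishesFrom (R Y : Type u) [CommRing R] [AddCommGroup Y] [Module R Y] (t : ℕ) : Prop :=
  ∀ (N : Type u) [AddCommGroup N] [Module R N] [Module.Finite R N] (j : ℕ), t ≤ j →
    Subsingleton (ModuleExt R N Y j)

theorem isSMulRegular_quotient_of_notMem {p : Ideal R} (hp : p.IsPrime) {x : R} (hx : x ∉ p) :
    IsSMulRegular (R ⧸ p) x := by
  refine isSMulRegular_iff_right_eq_zero_of_smul.mpr fun m hm ↦ ?_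
  obtain ⟨r, rfl⟩ := Ideal.Quotient.mk_surjective m
  rw [Algebra.smul_def, Ideal.Quotient.algebraMap_eq, ← map_mul,
    Ideal.Quotient.eq_zero_iff_mem] at hm
  exact Ideal.Quotient.eq_zero_iff_mem.mpr ((hp.mem_or_mem hm).resolve_left hx)

theorem exists_quotient_extension {M : Type u} [AddCommGroup M] [Module R M] {rs : List R}
    (hreg : IsWeaklyRegular M rs) (hM : ExtVanishesFrom R M (rs.length + 1)) {X Y : Type u}
    [AddCommGroup X] [Module R X] [AddCommGroup Y] [Module R Y] [Module.Finite R Y]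
    {f : X →ₗ[R] Y} (hf : Function.Injective f) (hY : ∀ r ∈ rs, r ∈ Module.annihilator R Y)
    (φ : X →ₗ[R] M ⧸ (Ideal.ofList rs • ⊤ : Submodule R M)) :
    ∃ ψ : Y →ₗ[R] M ⧸ (Ideal.ofList rs • ⊤ : Submodule R M), ψ ∘ₗ f = φ := by
  have hX : ∀ r ∈ rs, r ∈ Module.annihilator R X :=
    fun r hr ↦ f.annihilator_le_of_injective hf (hY r hr)
  obtain ⟨y, hy⟩ := (IsShortExact.mkQ_range hf).precomp_surjective M rs.length
    (hM _ _ le_rfl) (reesEquiv hreg hX φ)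
  obtain ⟨ψ, rfl⟩ := (reesEquiv hreg hY).surjective y
  exact ⟨ψ, (reesEquiv hreg hX).injective ((reesEquiv_comp hreg hY hX f ψ).trans hy)⟩

namespace ExtVanishesFrom

variable {Y : Type u} [AddCommGroup Y] [Module R Y] {t n : ℕ}

theorem mono (h : ExtVanishesFrom R Y t) (htn : t ≤ n) : ExtVanishesFrom R Y n :=
  fun N _ _ _ j hj ↦ h N j (htn.trans hj)

variable [IsNoetherianRing R] [IsLocalRing R] [Module.Finite R Y]

theorem subsingleton_ext_quotient_prime (h : ExtVanishesFrom R Y (t + 1)) {p : Ideal R}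
    (hp : p.IsPrime) (hne : p ≠ maximalIdeal R) : Subsingleton (ModuleExt R (R ⧸ p) Y t) := by
  obtain ⟨x, hx, hxp⟩ := SetLike.exists_of_lt ((le_maximalIdeal hp.ne_top).lt_of_ne hne)
  have hreg : IsWeaklyRegular (R ⧸ p) [x] :=
    (isWeaklyRegular_singleton_iff _ _).mpr (isSMulRegular_quotient_of_notMem hp hxp)
  exact subsingleton_ext_of_quotient (by simpa using hx) hreg t (h _ _ le_rfl)

theorem of_succ (h : ExtVanishesFrom R Y (t + 1))
    (hk : Subsingleton (ModuleExt R (R ⧸ maximalIdeal R) Y t)) : ExtVanishesFrom R Y t := by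
  intro N _ _ hN j hj
  rcases hj.lt_or_eq with hj | rfl
  · exact h N j hj
  induction hN using IsNoetherianRing.induction_on_isQuotientEquivQuotientPrime R with
  | subsingleton N => exact ModuleExt.subsingleton_of_subsingleton_left t
  | quotient N p e =>
    refine (ModuleExt.subsingleton_congr_left t e).mpr ?_
    by_cases hp : p.asIdeal = maximalIdeal R
    · rwa [hp]
    · exact h.subsingleton_ext_quotient_prime p.2 hp
  | exact N₁ N₂ N₃ f g hf hg hfg h₁ h₃ =>
    exact (IsShortExact.mk hf hfg hg).subsingleton_ext_middle Y t h₁ h₃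

theorem of_residueField (h : ExtVanishesFrom R Y n)
    (hk : ∀ j, t ≤ j → ExtVanishesFrom R Y (j + 1) →
      Subsingleton (ModuleExt R (R ⧸ maximalIdeal R) Y j)) : ExtVanishesFrom R Y t := by
  induction n with
  | zero => exact h.mono (Nat.zero_le t)
  | succ n ih =>
    rcases le_or_gt (n + 1) t with hle | hlt
    · exact h.mono hle
    · exact ih (h.of_succ (hk n (Nat.lt_succ_iff.mp hlt) h))

theorem exists_not_subsingleton_ext_residueField [Nontrivial Y] (h : ExtVanishesFrom R Y n) :
    ∃ i, ¬ Subsingleton (ModuleExt R (R ⧸ maximalIdeal R) Y i) := by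
  by_contra! hk
  have hhom := (h.of_residueField (t := 0) fun j _ _ ↦ hk j) Y 0 le_rfl
  rw [← (ModuleExt.homEquiv R Y Y).toEquiv.subsingleton_congr] at hhom
  obtain ⟨y, hy⟩ := exists_ne (0 : Y)
  exact hy (LinearMap.congr_fun (Subsingleton.elim LinearMap.id (0 : Y →ₗ[R] Y)) y)

theorem maximalIdeal_le_radical_of_isWeaklyRegular {rs : List R} (hreg : IsWeaklyRegular Y rs)
    (hrs : ∀ r ∈ rs, r ∈ maximalIdeal R) (h : ExtVanishesFrom R Y (rs.length + 1))
    (hk : ¬ Subsingleton (ModuleExt R (R ⧸ maximalIdeal R) Y rs.length)) :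
    maximalIdeal R ≤ (Ideal.ofList rs).radical := by
  refine maximalIdeal_le_radical_of_forall_isPrime fun p hp hle ↦ ?_
  by_contra hne
  have hann (q : Ideal R) (hq : ∀ r ∈ rs, r ∈ q) : ∀ r ∈ rs, r ∈ Module.annihilator R (R ⧸ q) := by
    rwa [Ideal.annihilator_quotient]
  have hp0 : Subsingleton ((R ⧸ p) →ₗ[R] Y ⧸ (Ideal.ofList rs • ⊤ : Submodule R Y)) :=
    (reesEquiv hreg (hann p fun r hr ↦ hle (Ideal.subset_span hr))).toEquiv.subsingleton_congr.mpr
      (h.subsingleton_ext_quotient_prime hp hne)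
  refine hk ((reesEquiv hreg (hann _ hrs)).toEquiv.subsingleton_congr.mp
    ⟨fun φ ψ ↦ Submodule.linearMap_qext _ ?_⟩)
  have hφψ := Subsingleton.elim (φ ∘ₗ Submodule.factor (le_maximalIdeal hp.ne_top))
    (ψ ∘ₗ Submodule.factor (le_maximalIdeal hp.ne_top))
  exact congrArg (· ∘ₗ p.mkQ) hφψ

theorem of_forall_lt (h : ExtVanishesFrom R R n)
    (hlt : ∀ i < t, Subsingleton (ModuleExt R (R ⧸ maximalIdeal R) R i))
    (ht : ¬ Subsingleton (ModuleExt R (R ⧸ maximalIdeal R) R t)) : ExtVanishesFrom R R (t + 1) := by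
  obtain ⟨rs, rfl, hmem, hreg⟩ := exists_isWeaklyRegular_of_subsingleton_ext (I := ⊤)
    (le_top.trans Ideal.le_radical) t hlt
  have hann : ∀ r ∈ rs, r ∈ Module.annihilator R (R ⧸ maximalIdeal R) := by
    rw [Ideal.annihilator_quotient]
    exact fun r hr ↦ (hmem r hr).1
  rw [← (reesEquiv hreg hann).toEquiv.subsingleton_congr, not_subsingleton_iff_nontrivial] at ht
  obtain ⟨φ, hφ⟩ :=
    exists_ne (0 : (R ⧸ maximalIdeal R) →ₗ[R] R ⧸ (Ideal.ofList rs • ⊤ : Submodule R R))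
  refine h.of_residueField fun j hj hj' ↦
    (IsShortExact.mkQ_range (injective_of_ne_zero_of_residueField hφ)).subsingleton_ext_left R j
      (subsingleton_ext_quotient_of_isWeaklyRegular 0 hreg HasNoHigherExt.of_free j
        (by omega)) (hj' _ _ le_rfl)

end ExtVanishesFrom

end ExtVanishing

section GorensteinRings

open RingTheory.Sequence IsLocalRing

variable {R : Type u} [CommRing R]

/-- Gorenstein local rings of Krull dimension `d`, the dimension being recorded as a natural number
since it is the degree in which the duality `Ext^d(-, R)` lives. -/
structure IsGorensteinOfDim (R : Type u) [CommRing R] (d : ℕ) : Prop where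
  isGorensteinLocalRing : IsGorensteinLocalRing R
  ringKrullDim_eq : ringKrullDim R = d

theorem IsGorensteinLocalRing.exists_isGorensteinOfDim (hR : IsGorensteinLocalRing R) :
    ∃ d, IsGorensteinOfDim R d := by
  have := hR.1
  have := hR.2.1
  exact ⟨_, hR, Order.krullDim_eq_length_of_finiteDimensionalOrder⟩

theorem IsGorensteinLocalRing.exists_extVanishesFrom (hR : IsGorensteinLocalRing R) :
    ∃ n, ExtVanishesFrom R R n := by
  obtain ⟨-, -, n, hn⟩ := hR
  exact ⟨n + 1, fun N _ _ _ j hj ↦ hn.subsingleton (ModuleCat.of R R) (n + 1) j hj _⟩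

theorem annihilator_quotient_ofList (rs : List R) :
    Module.annihilator R (R ⧸ (Ideal.ofList rs • ⊤ : Submodule R R)) = Ideal.ofList rs := by
  rw [smul_eq_mul, Ideal.mul_top, Ideal.annihilator_quotient]

theorem mem_annihilator_quotient_ofList (rs : List R) :
    ∀ r ∈ rs, r ∈ Module.annihilator R (R ⧸ (Ideal.ofList rs • ⊤ : Submodule R R)) := by
  rw [annihilator_quotient_ofList]
  exact fun r hr ↦ Ideal.subset_span hr

theorem ringKrullDim_eq_length [IsLocalRing R] [IsNoetherianRing R] {rs : List R}
    (hreg : IsWeaklyRegular R rs) (hrs : ∀ r ∈ rs, r ∈ maximalIdeal R)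
    (hrad : maximalIdeal R ≤ (Ideal.ofList rs).radical) : ringKrullDim R = rs.length := by
  rw [← ringKrullDim_add_length_eq_ringKrullDim_of_isRegular rs
    ((isRegular_iff_isWeaklyRegular_of_subset_maximalIdeal hrs).mpr hreg),
    ringKrullDim_quotient_eq_zero (I := Ideal.ofList rs) (Ideal.span_le.mpr hrs) hrad, zero_add]

theorem hasCyclicSocle_quotient_of_isWeaklyRegular [IsLocalRing R] {rs : List R}
    (hreg : IsWeaklyRegular R rs) (h : ExtVanishesFrom R R (rs.length + 1)) :
    HasCyclicSocle R (R ⧸ (Ideal.ofList rs • ⊤ : Submodule R R)) := by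
  intro a b ha hb ha0
  rcases eq_or_ne b 0 with rfl | hb0
  · exact ⟨0, zero_smul R a⟩
  obtain ⟨α, hα, rfl⟩ := exists_injective_of_residueField ha0 ha
  obtain ⟨β, -, rfl⟩ := exists_injective_of_residueField hb0 hb
  obtain ⟨ψ, rfl⟩ := exists_quotient_extension hreg h hα (mem_annihilator_quotient_ofList rs) β
  obtain ⟨c, rfl⟩ := exists_eq_smul_id_of_quotient ψ
  exact ⟨c, rfl⟩

namespace IsGorensteinOfDim

variable [IsLocalRing R] [IsNoetherianRing R] {d : ℕ}

theorem ext_residueField (hR : IsGorensteinOfDim R d) :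
    (∀ i < d, Subsingleton (ModuleExt R (R ⧸ maximalIdeal R) R i)) ∧
      ¬ Subsingleton (ModuleExt R (R ⧸ maximalIdeal R) R d) ∧ ExtVanishesFrom R R (d + 1) := by
  classical
  obtain ⟨n, hn⟩ := hR.isGorensteinLocalRing.exists_extVanishesFrom
  have hex := hn.exists_not_subsingleton_ext_residueField
  have hlt : ∀ i < Nat.find hex, Subsingleton (ModuleExt R (R ⧸ maximalIdeal R) R i) :=
    fun i hi ↦ not_not.mp (Nat.find_min hex hi)
  have hvan := hn.of_forall_lt hlt (Nat.find_spec hex)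
  obtain ⟨rs, hlen, hmem, hreg⟩ := exists_isWeaklyRegular_of_subsingleton_ext (I := ⊤)
    (le_top.trans Ideal.le_radical) _ hlt
  have hrs : ∀ r ∈ rs, r ∈ maximalIdeal R := fun r hr ↦ (hmem r hr).1
  have hdim := ringKrullDim_eq_length hreg hrs <|
    ExtVanishesFrom.maximalIdeal_le_radical_of_isWeaklyRegular hreg hrs (hlen ▸ hvan)
      (hlen ▸ Nat.find_spec hex)
  have hd : d = Nat.find hex := by
    rw [hR.ringKrullDim_eq, hlen] at hdim
    exact_mod_cast hdim
  exact hd ▸ ⟨hlt, Nat.find_spec hex, hvan⟩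

theorem subsingleton_ext_residueField (hR : IsGorensteinOfDim R d) (i : ℕ) (hi : i < d) :
    Subsingleton (ModuleExt R (R ⧸ maximalIdeal R) R i) :=
  hR.ext_residueField.1 i hi

theorem not_subsingleton_ext_residueField (hR : IsGorensteinOfDim R d) :
    ¬ Subsingleton (ModuleExt R (R ⧸ maximalIdeal R) R d) :=
  hR.ext_residueField.2.1

theorem extVanishesFrom (hR : IsGorensteinOfDim R d) : ExtVanishesFrom R R (d + 1) :=
  hR.ext_residueField.2.2

theorem exists_isWeaklyRegular (hR : IsGorensteinOfDim R d) {I : Ideal R}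
    (hI : maximalIdeal R ≤ I.radical) :
    ∃ rs : List R, rs.length = d ∧ (∀ r ∈ rs, r ∈ maximalIdeal R ⊓ I) ∧ IsWeaklyRegular R rs :=
  exists_isWeaklyRegular_of_subsingleton_ext hI d hR.subsingleton_ext_residueField

theorem maximalIdeal_le_radical {rs : List R} (hR : IsGorensteinOfDim R rs.length)
    (hrs : ∀ r ∈ rs, r ∈ maximalIdeal R) (hreg : IsWeaklyRegular R rs) :
    maximalIdeal R ≤ (Ideal.ofList rs).radical :=
  ExtVanishesFrom.maximalIdeal_le_radical_of_isWeaklyRegular hreg hrs hR.extVanishesFrom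
    hR.not_subsingleton_ext_residueField

theorem exists_ne_zero_residueField {rs : List R} (hR : IsGorensteinOfDim R rs.length)
    (hrs : ∀ r ∈ rs, r ∈ maximalIdeal R) (hreg : IsWeaklyRegular R rs) :
    ∃ β : (R ⧸ maximalIdeal R) →ₗ[R] R ⧸ (Ideal.ofList rs • ⊤ : Submodule R R), β ≠ 0 := by
  have hk : ∀ r ∈ rs, r ∈ Module.annihilator R (R ⧸ maximalIdeal R) := by
    rwa [Ideal.annihilator_quotient]
  have hnot := hR.not_subsingleton_ext_residueField
  rw [← (reesEquiv hreg hk).toEquiv.subsingleton_congr, not_subsingleton_iff_nontrivial] at hnot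
  exact exists_ne _

variable {C : Type u} [AddCommGroup C] [Module R C]

theorem subsingleton_ext_of_lt (hR : IsGorensteinOfDim R d)
    (hC : maximalIdeal R ≤ (Module.annihilator R C).radical) (j : ℕ) (hj : j < d) :
    Subsingleton (ModuleExt R C R j) := by
  obtain ⟨rs, rfl, hmem, hreg⟩ := hR.exists_isWeaklyRegular hC
  exact subsingleton_ext_of_lt_length hreg (fun r hr ↦ (hmem r hr).2) j hj

end IsGorensteinOfDim

theorem injective_of_hasCyclicSocle [IsLocalRing R] [IsNoetherianRing R] {C N : Type*}
    [AddCommGroup C] [Module R C] [AddCommGroup N] [Module R N]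
    (hC : maximalIdeal R ≤ (Module.annihilator R C).radical) (hsoc : HasCyclicSocle R C) {a : C}
    (ha : ∀ r ∈ maximalIdeal R, r • a = 0) {ψ : C →ₗ[R] N} (hψ : ψ a ≠ 0) :
    Function.Injective ψ := by
  rw [← LinearMap.ker_eq_bot]
  by_contra hker
  have : Nontrivial (LinearMap.ker ψ) := Submodule.nontrivial_iff_ne_bot.mpr hker
  obtain ⟨b, hb0, hb⟩ := exists_socle_element (LinearMap.ker ψ) <| hC.trans <|
    Ideal.radical_mono ((LinearMap.ker ψ).subtype.annihilator_le_of_injective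
      (LinearMap.ker ψ).subtype_injective)
  obtain ⟨c, hc⟩ := hsoc b a (fun r hr ↦ congrArg Subtype.val (hb r hr)) ha (by simpa using hb0)
  rw [← hc, map_smul, b.2, smul_zero] at hψ
  exact hψ rfl

theorem IsGorensteinOfDim.isPrincipal_ext_of_hasCyclicSocle [IsLocalRing R] [IsNoetherianRing R]
    {d : ℕ} (hR : IsGorensteinOfDim R d) {C : Type u} [AddCommGroup C] [Module R C]
    [Module.Finite R C] (hC : maximalIdeal R ≤ (Module.annihilator R C).radical)
    (hsoc : HasCyclicSocle R C) : (⊤ : Submodule R (ModuleExt R C R d)).IsPrincipal := by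
  rcases subsingleton_or_nontrivial C with _ | _
  · have := ModuleExt.subsingleton_of_subsingleton_left (R := R) (M := C) (Y := R) d
    exact ⟨0, Subsingleton.elim _ _⟩
  obtain ⟨rs, rfl, hmem, hreg⟩ := hR.exists_isWeaklyRegular hC
  have hann : ∀ r ∈ rs, r ∈ Module.annihilator R C := fun r hr ↦ (hmem r hr).2
  obtain ⟨a, ha0, ha⟩ := exists_socle_element C hC
  obtain ⟨α, hα, hαa⟩ := exists_injective_of_residueField ha0 ha
  obtain ⟨β, hβ⟩ := hR.exists_ne_zero_residueField (fun r hr ↦ (hmem r hr).1) hreg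
  obtain ⟨ψ, rfl⟩ := exists_quotient_extension hreg hR.extVanishesFrom hα hann β
  have hψ : Function.Injective ψ := injective_of_hasCyclicSocle hC hsoc ha fun h0 ↦
    hβ (Submodule.linearMap_qext _ (LinearMap.ext_ring ((congrArg ψ hαa).trans h0)))
  refine ⟨reesEquiv hreg hann ψ, le_antisymm (fun x _ ↦ ?_) le_top⟩
  obtain ⟨χ, rfl⟩ := (reesEquiv hreg hann).surjective x
  obtain ⟨θ, rfl⟩ := exists_quotient_extension hreg hR.extVanishesFrom hψ
    (mem_annihilator_quotient_ofList rs) χ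
  obtain ⟨c, rfl⟩ := exists_eq_smul_id_of_quotient θ
  exact Submodule.mem_span_singleton.mpr ⟨c, (map_smul _ c ψ).symm⟩

end GorensteinRings

section GorensteinQuotients

open RingTheory.Sequence IsLocalRing

variable {R S : Type u} [CommRing R] [IsLocalRing R] [CommRing S] [IsLocalRing S] [Algebra R S]

theorem algebraMap_mem_maximalIdeal_iff (hS : Function.Surjective (algebraMap R S)) {r : R} :
    algebraMap R S r ∈ maximalIdeal S ↔ r ∈ maximalIdeal R := by
  have : IsLocalHom (algebraMap R S) := IsLocalHom.of_surjective _ hS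
  rw [mem_maximalIdeal, mem_maximalIdeal, mem_nonunits_iff, mem_nonunits_iff, isUnit_map_iff]

theorem HasCyclicSocle.congr {M N : Type*} [AddCommGroup M] [Module R M] [AddCommGroup N]
    [Module R N] (h : HasCyclicSocle R M) (e : M ≃ₗ[R] N) : HasCyclicSocle R N := by
  intro a b ha hb ha0
  obtain ⟨c, hc⟩ := h (e.symm a) (e.symm b) (fun r hr ↦ by rw [← map_smul, ha r hr, map_zero])
    (fun r hr ↦ by rw [← map_smul, hb r hr, map_zero]) (e.symm.map_ne_zero_iff.mpr ha0)
  exact ⟨c, e.symm.injective ((map_smul _ c a).trans hc)⟩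

section RestrictScalars

variable {N : Type*} [AddCommGroup N] [Module R N] [Module S N] [IsScalarTower R S N]

theorem HasCyclicSocle.restrictScalars (hS : Function.Surjective (algebraMap R S))
    (h : HasCyclicSocle S N) : HasCyclicSocle R N := by
  have hsocle {a : N} (ha : ∀ r ∈ maximalIdeal R, r • a = 0) :
      ∀ s ∈ maximalIdeal S, s • a = 0 := by
    intro s hs
    obtain ⟨r, rfl⟩ := hS s
    rw [algebraMap_smul]
    exact ha r ((algebraMap_mem_maximalIdeal_iff hS).mp hs)
  intro a b ha hb ha0
  obtain ⟨s, hs⟩ := h a b (hsocle ha) (hsocle hb) ha0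
  obtain ⟨r, rfl⟩ := hS s
  exact ⟨r, (algebraMap_smul S r a).symm.trans hs⟩

theorem maximalIdeal_le_radical_annihilator_restrictScalars
    (hS : Function.Surjective (algebraMap R S))
    (h : maximalIdeal S ≤ (Module.annihilator S N).radical) :
    maximalIdeal R ≤ (Module.annihilator R N).radical := by
  intro r hr
  obtain ⟨n, hn⟩ := h ((algebraMap_mem_maximalIdeal_iff hS).mpr hr)
  refine ⟨n, Module.mem_annihilator.mpr fun a ↦ ?_⟩
  rw [← algebraMap_smul S, map_pow]
  exact Module.mem_annihilator.mp hn a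

end RestrictScalars

/-- Dividing out a sequence of `R`, or its image in the `R`-algebra `S`, from `S` gives the same
`R`-module. -/
noncomputable def quotientOfListMapEquiv (S : Type u) [CommRing S] [Algebra R S] (rs : List R) :
    (S ⧸ (Ideal.ofList (rs.map (algebraMap R S)) • ⊤ : Submodule S S)) ≃ₗ[R]
      S ⧸ (Ideal.ofList rs • ⊤ : Submodule R S) :=
  (Submodule.Quotient.restrictScalarsEquiv R _).symm ≪≫ₗ Submodule.quotEquivOfEq _ _ (by
    rw [← Ideal.map_ofList, Ideal.smul_restrictScalars, Submodule.restrictScalars_top])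

namespace IsGorensteinOfDim

variable [IsNoetherianRing R] {d s : ℕ}

theorem exists_isWeaklyRegular_of_surjective (hS : IsGorensteinOfDim S s)
    (hsurj : Function.Surjective (algebraMap R S)) :
    ∃ rs : List R, rs.length = s ∧ (∀ r ∈ rs, r ∈ maximalIdeal R) ∧ IsWeaklyRegular S rs ∧
      maximalIdeal R ≤
        (Module.annihilator R (S ⧸ (Ideal.ofList rs • ⊤ : Submodule R S))).radical ∧
      HasCyclicSocle R (S ⧸ (Ideal.ofList rs • ⊤ : Submodule R S)) := by
  have := isNoetherianRing_of_surjective R S _ hsurj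
  obtain ⟨ys, rfl, hmem, hreg⟩ := hS.exists_isWeaklyRegular (I := ⊤) (le_top.trans Ideal.le_radical)
  obtain ⟨rs, rfl⟩ := List.map_surjective_iff.mpr hsurj ys
  have hmem' : ∀ y ∈ rs.map (algebraMap R S), y ∈ maximalIdeal S := fun y hy ↦ (hmem y hy).1
  have hrad := hS.maximalIdeal_le_radical hmem' hreg
  rw [← annihilator_quotient_ofList] at hrad
  refine ⟨rs, by rw [List.length_map], fun r hr ↦ (algebraMap_mem_maximalIdeal_iff hsurj).mp
    (hmem' _ (List.mem_map_of_mem hr)), (isWeaklyRegular_map_algebraMap_iff S S rs).mp hreg, ?_, ?_⟩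
  · rw [← (quotientOfListMapEquiv S rs).annihilator_eq]
    exact maximalIdeal_le_radical_annihilator_restrictScalars hsurj hrad
  · exact ((hasCyclicSocle_quotient_of_isWeaklyRegular hreg hS.extVanishesFrom).restrictScalars
      hsurj).congr (quotientOfListMapEquiv S rs)

theorem isPrincipal_ext_of_surjective (hR : IsGorensteinOfDim R d) (hS : IsGorensteinOfDim S s)
    (hsurj : Function.Surjective (algebraMap R S)) (i : ℕ) (hi : i + s = d) :
    (⊤ : Submodule R (ModuleExt R S R i)).IsPrincipal := by
  have := Module.Finite.of_surjective (Algebra.linearMap R S) hsurj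
  obtain ⟨rs, rfl, hmem, hreg, hsupp, hsoc⟩ := hS.exists_isWeaklyRegular_of_surjective hsurj
  exact isPrincipal_ext_of_quotient hmem hreg i (hR.extVanishesFrom _ _ (by omega))
    (hi ▸ hR.isPrincipal_ext_of_hasCyclicSocle hsupp hsoc)

theorem subsingleton_ext_of_surjective (hR : IsGorensteinOfDim R d) (hS : IsGorensteinOfDim S s)
    (hsurj : Function.Surjective (algebraMap R S)) (i : ℕ) (hi : i + s ≠ d) :
    Subsingleton (ModuleExt R S R i) := by
  have := Module.Finite.of_surjective (Algebra.linearMap R S) hsurj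
  obtain ⟨rs, rfl, hmem, hreg, hsupp, -⟩ := hS.exists_isWeaklyRegular_of_surjective hsurj
  rcases hi.lt_or_gt with hi | hi
  · exact subsingleton_ext_of_quotient hmem hreg i (hR.subsingleton_ext_of_lt hsupp _ hi)
  · exact subsingleton_ext_of_quotient hmem hreg i (hR.extVanishesFrom _ _ hi)

end IsGorensteinOfDim

end GorensteinQuotients

section HeightOne

variable {R : Type u} [CommRing R] [IsDomain R]

theorem exists_not_dvd_forall_dvd_mul [IsNoetherianRing R] {p : Ideal R} (hp : p.IsPrime)
    (hp1 : p.height = 1) {a : R} (hap : a ∈ p) (ha0 : a ≠ 0) :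
    ∃ b : R, ¬ a ∣ b ∧ ∀ r ∈ p, a ∣ r * b := by
  have hmin : p ∈ (Module.annihilator R (R ⧸ Ideal.span {a})).minimalPrimes := by
    rw [Ideal.annihilator_quotient]
    refine Ideal.mem_minimalPrimes_of_height_le ((Ideal.span_singleton_le_iff_mem p).mpr hap) ?_
    rw [hp1]
    exact Ideal.one_le_height_span_singleton_of_mem_nonZeroDivisors
      (mem_nonZeroDivisors_of_ne_zero ha0)
  obtain ⟨-, b, hb⟩ := isAssociatedPrime_iff.mp
    (Module.associatedPrimes.minimalPrimes_annihilator_subset_associatedPrimes R _ hmin)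
  obtain ⟨b, rfl⟩ := Ideal.Quotient.mk_surjective b
  have hdvd (r : R) : r ∈ p ↔ a ∣ r * b := by
    rw [hb, Submodule.mem_colon_singleton, Submodule.mem_bot, ← Ideal.mem_span_singleton,
      ← Ideal.Quotient.eq_zero_iff_mem, map_mul]
    rfl
  exact ⟨b, fun h ↦ hp.ne_top ((Ideal.eq_top_iff_one p).mpr ((hdvd 1).mpr (by rwa [one_mul]))),
    fun r ↦ (hdvd r).mp⟩

theorem exists_linearMap_mul_eq {I : Ideal R} {a b : R} (ha0 : a ≠ 0) (hb : ∀ r ∈ I, a ∣ r * b) :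
    ∃ φ : I →ₗ[R] R, ∀ x : I, a * φ x = b * x := by
  have hrange (x : I) : (b • I.subtype) x ∈ LinearMap.range (LinearMap.lsmul R R a) := by
    obtain ⟨c, hc⟩ := hb x x.2
    exact ⟨c, by simp [← hc, mul_comm b]⟩
  let e := LinearEquiv.ofInjective (LinearMap.lsmul R R a) (LinearMap.lsmul_injective ha0)
  refine ⟨e.symm ∘ₗ (b • I.subtype).codRestrict _ hrange, fun x ↦ ?_⟩
  exact congrArg Subtype.val (e.apply_symm_apply ((b • I.subtype).codRestrict _ hrange x))

theorem exists_linearMap_ne_smul_subtype_of_height_eq_one [IsNoetherianRing R] {I : Ideal R}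
    (hI : I.height = 1) : ∃ φ : I →ₗ[R] R, ∀ r : R, φ ≠ r • I.subtype := by
  obtain ⟨a, haI, ha0⟩ := Submodule.exists_mem_ne_zero_of_ne_bot (Ideal.ne_bot_of_height_one hI)
  obtain ⟨p, hp, hpI, hp1⟩ := Ideal.exists_isPrime_height_eq (n := 1) (by exact_mod_cast hI)
  obtain ⟨b, hab, hb⟩ := exists_not_dvd_forall_dvd_mul hp (by exact_mod_cast hp1) (hpI haI) ha0
  obtain ⟨φ, hφ⟩ := exists_linearMap_mul_eq (I := I) ha0 fun r hr ↦ hb r (hpI hr)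
  refine ⟨φ, ?_⟩
  rintro r rfl
  have hra : a * (r * a) = b * a := hφ ⟨a, haI⟩
  exact hab ⟨r, mul_right_cancel₀ ha0 (by rw [← hra, mul_assoc])⟩

end HeightOne

section ModuleDepth

open RingTheory.Sequence IsLocalRing

section LocalRing

variable {A : Type*} [CommRing A] [IsLocalRing A] {M : Type*} [AddCommGroup M] [Module A M]

theorem moduleDepth_congr {N : Type*} [AddCommGroup N] [Module A N] (e : M ≃ₗ[A] N) :
    moduleDepth A M = moduleDepth A N := by
  simp only [moduleDepth, e.isWeaklyRegular_congr]

theorem natCast_le_moduleDepth_iff {n : ℕ} : (n : ℕ∞) ≤ moduleDepth A M ↔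
    ∃ rs : List A, rs.length = n ∧ (∀ r ∈ rs, r ∈ maximalIdeal A) ∧ IsWeaklyRegular M rs := by
  constructor
  · intro h
    rcases n with _ | n
    · exact ⟨[], rfl, fun _ h ↦ absurd h List.not_mem_nil, .nil A M⟩
    have hlt : (n : ℕ∞) < moduleDepth A M := lt_of_lt_of_le (by exact_mod_cast n.lt_succ_self) h
    obtain ⟨rs, hrs⟩ := lt_iSup_iff.mp hlt
    obtain ⟨⟨hmem, hreg⟩, hlen⟩ := lt_iSup_iff.mp hrs
    rw [← List.take_append_drop (n + 1) rs, isWeaklyRegular_append_iff] at hreg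
    exact ⟨rs.take (n + 1), List.length_take_of_le (by exact_mod_cast hlen),
      fun r hr ↦ hmem r (List.mem_of_mem_take hr), hreg.1⟩
  · rintro ⟨rs, rfl, hmem, hreg⟩
    exact le_iSup₂_of_le rs ⟨hmem, hreg⟩ le_rfl

theorem moduleDepth_restrictScalars {R S : Type u} [CommRing R] [IsLocalRing R] [CommRing S]
    [IsLocalRing S] [Algebra R S] (hS : Function.Surjective (algebraMap R S)) (N : Type*)
    [AddCommGroup N] [Module R N] [Module S N] [IsScalarTower R S N] :
    moduleDepth R N = moduleDepth S N := by
  refine le_antisymm ?_ ?_ <;> refine ENat.forall_natCast_le_iff_le.mp fun n hn ↦ ?_ <;>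
    obtain ⟨rs, rfl, hmem, hreg⟩ := natCast_le_moduleDepth_iff.mp hn
  · refine natCast_le_moduleDepth_iff.mpr ⟨rs.map (algebraMap R S), List.length_map _, ?_,
      (isWeaklyRegular_map_algebraMap_iff S N rs).mpr hreg⟩
    exact List.forall_mem_map.mpr fun r hr ↦ (algebraMap_mem_maximalIdeal_iff hS).mpr (hmem r hr)
  · obtain ⟨rs, rfl⟩ := List.map_surjective_iff.mpr hS rs
    exact natCast_le_moduleDepth_iff.mpr ⟨rs, (List.length_map _).symm,
      fun r hr ↦ (algebraMap_mem_maximalIdeal_iff hS).mp (hmem _ (List.mem_map_of_mem hr)),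
      (isWeaklyRegular_map_algebraMap_iff S N rs).mp hreg⟩

end LocalRing

section Noetherian

variable {R : Type u} [CommRing R] [IsLocalRing R]
  {M N P : Type u} [AddCommGroup M] [Module R M] [AddCommGroup N] [Module R N]
  [AddCommGroup P] [Module R P]

theorem subsingleton_ext_residueField_of_natCast_le_moduleDepth {n : ℕ}
    (h : (n : ℕ∞) ≤ moduleDepth R M) (i : ℕ) (hi : i < n) :
    Subsingleton (ModuleExt R (R ⧸ maximalIdeal R) M i) := by
  obtain ⟨rs, rfl, hmem, hreg⟩ := natCast_le_moduleDepth_iff.mp h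
  exact subsingleton_ext_of_lt_length hreg (by rwa [Ideal.annihilator_quotient]) i hi

variable [IsNoetherianRing R]

theorem natCast_le_moduleDepth_iff_subsingleton_ext [Module.Finite R M] {n : ℕ} :
    (n : ℕ∞) ≤ moduleDepth R M ↔
      ∀ i < n, Subsingleton (ModuleExt R (R ⧸ maximalIdeal R) M i) := by
  refine ⟨subsingleton_ext_residueField_of_natCast_le_moduleDepth, fun h ↦ ?_⟩
  obtain ⟨rs, hlen, hmem, hreg⟩ :=
    exists_isWeaklyRegular_of_subsingleton_ext (I := ⊤) (le_top.trans Ideal.le_radical) n h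
  exact natCast_le_moduleDepth_iff.mpr ⟨rs, hlen, fun r hr ↦ (hmem r hr).1, hreg⟩

theorem one_le_moduleDepth_of_injective [Module.Finite R M] {f : M →ₗ[R] N}
    (hf : Function.Injective f) (hN : 1 ≤ moduleDepth R N) : 1 ≤ moduleDepth R M := by
  refine (Nat.cast_one (R := ℕ∞)).symm.trans_le
    (natCast_le_moduleDepth_iff_subsingleton_ext.mpr fun i hi ↦ ?_)
  obtain rfl := Nat.lt_one_iff.mp hi
  have := subsingleton_ext_residueField_of_natCast_le_moduleDepth (n := 1) hN 0 one_pos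
  exact (ModuleExt.postcomp_zero_injective hf).subsingleton

theorem IsShortExact.natCast_succ_le_moduleDepth [Module.Finite R M] {f : M →ₗ[R] N}
    {g : N →ₗ[R] P} (h : IsShortExact f g) {n : ℕ} (hN : ((n + 1 : ℕ) : ℕ∞) ≤ moduleDepth R N)
    (hP : (n : ℕ∞) ≤ moduleDepth R P) : ((n + 1 : ℕ) : ℕ∞) ≤ moduleDepth R M := by
  refine natCast_le_moduleDepth_iff_subsingleton_ext.mpr fun i hi ↦ ?_
  have hNi := subsingleton_ext_residueField_of_natCast_le_moduleDepth hN i hi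
  rcases i with _ | i
  · exact (ModuleExt.postcomp_zero_injective h.injective).subsingleton
  · exact h.subsingleton_ext_to_left _ i
      (subsingleton_ext_residueField_of_natCast_le_moduleDepth hP i (by omega)) hNi

end Noetherian

end ModuleDepth

section Localization

open RingTheory.Sequence IsLocalRing

variable {R : Type u} [CommRing R] {M N : Type u} [AddCommGroup M] [Module R M] [AddCommGroup N]
  [Module R N]

theorem bijective_smul_localizedModule {S : Submonoid R} (s : S) :
    Function.Bijective fun x : LocalizedModule S N ↦ (s : R) • x :=
  (Module.End.isUnit_iff _).mp (IsLocalizedModule.map_units (LocalizedModule.mkLinearMap S N) s)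

theorem localizedModule_map_comp_of_comp_eq_lsmul {S : Submonoid R} {φ : M →ₗ[R] N}
    {ψ : N →ₗ[R] M} {s : R} (h : φ ∘ₗ ψ = LinearMap.lsmul R _ s) (x : LocalizedModule S N) :
    LocalizedModule.map S φ (LocalizedModule.map S ψ x) = s • x := by
  induction x using LocalizedModule.induction_on with | _ m t
  rw [LocalizedModule.map_mk, LocalizedModule.map_mk, LocalizedModule.smul'_mk]
  exact congrArg (LocalizedModule.mk · t) (LinearMap.congr_fun h m)

theorem localizedModule_map_bijective {S : Submonoid R} {φ : M →ₗ[R] N} {ψ : N →ₗ[R] M} (s : S)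
    (hφψ : φ ∘ₗ ψ = LinearMap.lsmul R _ s) (hψφ : ψ ∘ₗ φ = LinearMap.lsmul R _ s) :
    Function.Bijective (LocalizedModule.map S φ) := by
  refine ⟨fun x y hxy ↦ (bijective_smul_localizedModule s).1 ?_, fun y ↦ ?_⟩
  · dsimp only
    rw [← localizedModule_map_comp_of_comp_eq_lsmul hψφ,
      ← localizedModule_map_comp_of_comp_eq_lsmul hψφ, hxy]
  · obtain ⟨z, rfl⟩ := (bijective_smul_localizedModule s).2 y
    exact ⟨_, localizedModule_map_comp_of_comp_eq_lsmul hφψ z⟩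

theorem moduleDepth_localizedModule_congr {p : Ideal R} [p.IsPrime] {φ : M →ₗ[R] N}
    {ψ : N →ₗ[R] M} {s : R} (hs : s ∉ p) (hφψ : φ ∘ₗ ψ = LinearMap.lsmul R _ s)
    (hψφ : ψ ∘ₗ φ = LinearMap.lsmul R _ s) :
    moduleDepth (Localization.AtPrime p) (LocalizedModule p.primeCompl M) =
      moduleDepth (Localization.AtPrime p) (LocalizedModule p.primeCompl N) :=
  moduleDepth_congr (LinearEquiv.ofBijective _
    (localizedModule_map_bijective (S := p.primeCompl) ⟨s, hs⟩ hφψ hψφ))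

theorem IsMaximalCohenMacaulay.congr (h : IsMaximalCohenMacaulay R M) (e : M ≃ₗ[R] N) :
    IsMaximalCohenMacaulay R N := by
  have := h.1
  refine ⟨Module.Finite.equiv e, fun p hp ↦ (h.2 p).trans_eq ?_⟩
  refine moduleDepth_localizedModule_congr (φ := e.toLinearMap) (ψ := e.symm.toLinearMap) (s := 1)
    (fun h ↦ hp.ne_top ((Ideal.eq_top_iff_one p).mpr h)) ?_ ?_ <;> ext <;> simp

variable [IsLocalRing R]

theorem moduleDepth_localizedModule_maximalIdeal (M : Type u) [AddCommGroup M] [Module R M] :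
    moduleDepth (Localization.AtPrime (maximalIdeal R))
      (LocalizedModule (maximalIdeal R).primeCompl M) = moduleDepth R M := by
  have hunit : (maximalIdeal R).primeCompl ≤ IsUnit.submonoid R := fun x hx ↦ by
    simpa [IsUnit.mem_submonoid_iff] using hx
  have : IsLocalization (maximalIdeal R).primeCompl R := .self hunit
  have := isLocalizedModule_id (maximalIdeal R).primeCompl M R
  let e : M ≃ₗ[R] LocalizedModule (maximalIdeal R).primeCompl M :=
    IsLocalizedModule.linearEquiv (maximalIdeal R).primeCompl LinearMap.id
      (LocalizedModule.mkLinearMap (maximalIdeal R).primeCompl M)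
  rw [moduleDepth_congr e]
  exact (moduleDepth_restrictScalars (IsLocalization.atUnits R _ hunit).surjective _).symm

variable {d : ℕ}

theorem IsMaximalCohenMacaulay.natCast_le_moduleDepth (h : IsMaximalCohenMacaulay R M)
    (hd : ringKrullDim R = d) : (d : ℕ∞) ≤ moduleDepth R M := by
  have hheight : (maximalIdeal R).height = d := by
    exact_mod_cast maximalIdeal_height_eq_ringKrullDim.trans hd
  rw [← hheight, ← moduleDepth_localizedModule_maximalIdeal]
  exact h.2 (maximalIdeal R)

theorem isMaximalCohenMacaulay_of_natCast_le_moduleDepth [Module.Finite R M]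
    (hd : ringKrullDim R = d) (h : (d : ℕ∞) ≤ moduleDepth R M)
    (h' : ∀ (p : Ideal R) [p.IsPrime], p ≠ maximalIdeal R → p.height ≤
      moduleDepth (Localization.AtPrime p) (LocalizedModule p.primeCompl M)) :
    IsMaximalCohenMacaulay R M := by
  refine ⟨inferInstance, fun p hp ↦ ?_⟩
  rcases eq_or_ne p (maximalIdeal R) with rfl | hpm
  · have hheight : (maximalIdeal R).height = d := by
      exact_mod_cast maximalIdeal_height_eq_ringKrullDim.trans hd
    rwa [moduleDepth_localizedModule_maximalIdeal, hheight]
  · exact h' p hpm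

end Localization

section Duality

open RingTheory.Sequence IsLocalRing

variable {R : Type u} [CommRing R] {M N P : Type u} [AddCommGroup M] [Module R M]
  [AddCommGroup N] [Module R N] [AddCommGroup P] [Module R P] {f : M →ₗ[R] N} {g : N →ₗ[R] P}

theorem IsShortExact.exists_comp_eq {Y : Type u} [AddCommGroup Y] [Module R Y]
    (h : IsShortExact f g) (hP : Subsingleton (ModuleExt R P Y 1)) (φ : M →ₗ[R] Y) :
    ∃ ψ : N →ₗ[R] Y, ψ ∘ₗ f = φ := by
  obtain ⟨y, hy⟩ := h.precomp_surjective Y 0 hP (ModuleExt.homEquiv R M Y φ)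
  obtain ⟨ψ, rfl⟩ := (ModuleExt.homEquiv R N Y).surjective y
  exact ⟨ψ, (ModuleExt.homEquiv R M Y).injective ((ModuleExt.precomp_homEquiv f ψ).symm.trans hy)⟩

theorem IsShortExact.dual (h : IsShortExact f g) (hP : Subsingleton (ModuleExt R P R 1)) :
    IsShortExact g.dualMap f.dualMap where
  injective := LinearMap.dualMap_injective_of_surjective h.surjective
  exact := LinearMap.exact_lcomp_of_exact_of_surjective R h.exact h.surjective
  surjective := h.exists_comp_eq hP

theorem HasNoHigherExt.of_isShortExact {Y : Type u} [AddCommGroup Y] [Module R Y]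
    (h : IsShortExact f g) (hN : HasNoHigherExt R N Y) (hP : HasNoHigherExt R P Y) :
    HasNoHigherExt R M Y :=
  fun j hj ↦ h.subsingleton_ext_left Y j (hN j hj) (hP (j + 1) j.succ_pos)

variable [IsLocalRing R] [IsNoetherianRing R] {d : ℕ}

namespace IsGorensteinOfDim

theorem natCast_le_moduleDepth_of_free (hR : IsGorensteinOfDim R d) [Module.Free R M] :
    (d : ℕ∞) ≤ moduleDepth R M := by
  obtain ⟨rs, hlen, hmem, hreg⟩ :=
    hR.exists_isWeaklyRegular (I := ⊤) (le_top.trans Ideal.le_radical)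
  exact natCast_le_moduleDepth_iff.mpr ⟨rs, hlen, fun r hr ↦ (hmem r hr).1,
    ((TensorProduct.rid R M).isWeaklyRegular_congr rs).mp (hreg.isWeaklyRegular_lTensor (M₂ := M))⟩

theorem subsingleton_ext_of_natCast_le_moduleDepth (hR : IsGorensteinOfDim R d)
    [Module.Finite R M] {r : ℕ} (h : (r : ℕ∞) ≤ moduleDepth R M) (j : ℕ) (hj : d < j + r) :
    Subsingleton (ModuleExt R M R j) := by
  obtain ⟨rs, rfl, hmem, hreg⟩ := natCast_le_moduleDepth_iff.mp h
  exact subsingleton_ext_of_quotient hmem hreg j (hR.extVanishesFrom _ _ hj)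

theorem hasNoHigherExt_of_natCast_le_moduleDepth (hR : IsGorensteinOfDim R d) [Module.Finite R M]
    (h : (d : ℕ∞) ≤ moduleDepth R M) : HasNoHigherExt R M R :=
  fun j hj ↦ hR.subsingleton_ext_of_natCast_le_moduleDepth h j (by omega)

theorem one_le_moduleDepth_dual (hR : IsGorensteinOfDim R d) (hd : 1 ≤ d) (M : Type u)
    [AddCommGroup M] [Module R M] [Module.Finite R M] : 1 ≤ moduleDepth R (Module.Dual R M) := by
  obtain ⟨n, g, hg⟩ := Module.Finite.exists_fin' R M
  exact one_le_moduleDepth_of_injective (LinearMap.dualMap_injective_of_surjective hg)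
    (le_trans (by exact_mod_cast hd) hR.natCast_le_moduleDepth_of_free)

theorem two_le_moduleDepth_dual (hR : IsGorensteinOfDim R d) (hd : 2 ≤ d) (M : Type u)
    [AddCommGroup M] [Module R M] [Module.Finite R M] : 2 ≤ moduleDepth R (Module.Dual R M) := by
  obtain ⟨n, g, hg⟩ := Module.Finite.exists_fin' R M
  have hexact :=
    LinearMap.exact_lcomp_of_exact_of_surjective R (LinearMap.exact_subtype_ker_map g) hg
  refine (IsShortExact.rangeRestrict (LinearMap.dualMap_injective_of_surjective hg)
    hexact).natCast_succ_le_moduleDepth (n := 1)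
    (le_trans (by exact_mod_cast hd) hR.natCast_le_moduleDepth_of_free) ?_
  exact one_le_moduleDepth_of_injective (Submodule.subtype_injective _)
    (hR.one_le_moduleDepth_dual (one_le_two.trans hd) (LinearMap.ker g))

theorem natCast_le_moduleDepth_dual (hR : IsGorensteinOfDim R d) [Module.Finite R M]
    (hM : HasNoHigherExt R M R) : (d : ℕ∞) ≤ moduleDepth R (Module.Dual R M) := by
  suffices h : ∀ n ≤ d, (n : ℕ∞) ≤ moduleDepth R (Module.Dual R M) from h d le_rfl
  intro n
  induction n generalizing M with
  | zero => exact fun _ ↦ zero_le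
  | succ n ih =>
    intro hn
    obtain ⟨m, g, hg⟩ := Module.Finite.exists_fin' R M
    have hexact := IsShortExact.subtype_ker hg
    exact (hexact.dual (hM 1 one_pos)).natCast_succ_le_moduleDepth
      (le_trans (by exact_mod_cast hn) hR.natCast_le_moduleDepth_of_free)
      (ih (.of_isShortExact hexact .of_free hM) (by omega))

theorem bidual_surjective (hR : IsGorensteinOfDim R d) [Module.Finite R M]
    (hM : HasNoHigherExt R M R) : Function.Surjective (Module.Dual.eval R M) := by
  intro ψ
  obtain ⟨n, g, hg⟩ := Module.Finite.exists_fin' R M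
  have hexact := IsShortExact.subtype_ker hg
  have hker : HasNoHigherExt R (LinearMap.ker g) R := .of_isShortExact hexact .of_free hM
  have hdual := hR.hasNoHigherExt_of_natCast_le_moduleDepth (hR.natCast_le_moduleDepth_dual hker)
  obtain ⟨Ψ, rfl⟩ := (hexact.dual (hM 1 one_pos)).exists_comp_eq (hdual 1 one_pos) ψ
  obtain ⟨v, rfl⟩ := (Module.evalEquiv R (Fin n → R)).surjective Ψ
  exact ⟨g v, rfl⟩

end IsGorensteinOfDim

end Duality

section GorensteinHeightOne

open IsLocalRing

variable {R : Type u} [CommRing R]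

theorem comp_subtype_eq_smul_subtype {I : Ideal R} (ψ : R →ₗ[R] R) :
    ψ ∘ₗ I.subtype = ψ 1 • I.subtype := by
  ext x
  simpa [mul_comm] using ψ.map_smul (x : R) 1

namespace IsGorensteinOfDim

variable [IsLocalRing R] [IsNoetherianRing R] [IsDomain R] {d : ℕ} {I : Ideal R}

theorem exists_isGorensteinOfDim_quotient (hR : IsGorensteinOfDim R d) (hI : I.IsGorenstein)
    (hI1 : I.height = 1) : ∃ s, s + 1 = d ∧ IsGorensteinOfDim (R ⧸ I) s := by
  have : IsLocalRing (R ⧸ I) := hI.2.1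
  obtain ⟨s, hs⟩ := IsGorensteinLocalRing.exists_isGorensteinOfDim hI
  refine ⟨s, le_antisymm ?_ ?_, hs⟩
  · obtain ⟨a, haI, ha0⟩ := Submodule.exists_mem_ne_zero_of_ne_bot (Ideal.ne_bot_of_height_one hI1)
    have hle : ringKrullDim (R ⧸ I) ≤ ringKrullDim (R ⧸ Ideal.span {a}) :=
      ringKrullDim_le_of_surjective _ (Ideal.Quotient.factor_surjective
        ((Ideal.span_singleton_le_iff_mem I).mpr haI))
    have hsucc := (add_le_add_left hle 1).trans
      (ringKrullDim_quotient_succ_le_of_nonZeroDivisor (mem_nonZeroDivisors_of_ne_zero ha0))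
    rw [hs.ringKrullDim_eq, hR.ringKrullDim_eq] at hsucc
    exact_mod_cast hsucc
  · by_contra! hlt
    obtain ⟨φ, hφ⟩ := exists_linearMap_ne_smul_subtype_of_height_eq_one hI1
    obtain ⟨ψ, rfl⟩ := (IsShortExact.subtype_mkQ I).exists_comp_eq
      (hR.subsingleton_ext_of_surjective hs Ideal.Quotient.mk_surjective 1 (by omega)) φ
    exact hφ (ψ 1) (comp_subtype_eq_smul_subtype ψ)

theorem exists_dual_generator (hR : IsGorensteinOfDim R d) (hI : I.IsGorenstein)
    (hI1 : I.height = 1) :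
    ∃ f : I →ₗ[R] R, ∀ φ : I →ₗ[R] R, ∃ a b : R, φ = a • I.subtype + b • f := by
  have : IsLocalRing (R ⧸ I) := hI.2.1
  obtain ⟨s, hs, hquot⟩ := hR.exists_isGorensteinOfDim_quotient hI hI1
  have hexact := IsShortExact.subtype_mkQ I
  obtain ⟨ε, hε⟩ := (hR.isPrincipal_ext_of_surjective hquot Ideal.Quotient.mk_surjective 1
    (by omega)).principal
  let δ := hexact.precompConnecting R 0 ∘ₗ (ModuleExt.homEquiv R I R).toLinearMap
  have hδ : Function.Surjective δ := (surjective_of_exact_of_subsingleton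
    (hexact.exact_connecting_precomp R 0) (HasNoHigherExt.of_free _ one_pos)).comp
      (ModuleExt.homEquiv R I R).surjective
  obtain ⟨f, rfl⟩ := hδ ε
  refine ⟨f, fun φ ↦ ?_⟩
  obtain ⟨b, hb⟩ := Submodule.mem_span_singleton.mp (hε ▸ Submodule.mem_top : δ φ ∈ R ∙ δ f)
  have hker : δ (φ - b • f) = 0 := by rw [map_sub, map_smul, hb, sub_self]
  obtain ⟨ψ, hψ⟩ := (hexact.exact_precomp_connecting R 0 _).mp hker
  obtain ⟨ψ, rfl⟩ := (ModuleExt.homEquiv R R R).surjective ψ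
  rw [ModuleExt.precomp_homEquiv, comp_subtype_eq_smul_subtype] at hψ
  exact ⟨ψ 1, b, sub_eq_iff_eq_add.mp ((ModuleExt.homEquiv R I R).injective hψ).symm⟩

theorem hasNoHigherExt_ideal (hR : IsGorensteinOfDim R d) (hI : I.IsGorenstein)
    (hI1 : I.height = 1) : HasNoHigherExt R I R := by
  intro j hj
  have : IsLocalRing (R ⧸ I) := hI.2.1
  obtain ⟨s, hs, hquot⟩ := hR.exists_isGorensteinOfDim_quotient hI hI1
  exact (IsShortExact.subtype_mkQ I).subsingleton_ext_left R j (HasNoHigherExt.of_free j hj)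
    (hR.subsingleton_ext_of_surjective hquot Ideal.Quotient.mk_surjective (j + 1) (by omega))

end IsGorensteinOfDim

end GorensteinHeightOne

section Divisorial

open FractionalIdeal

variable {R : Type u} [CommRing R]

section Multipliers

variable {N : Type*} [AddCommGroup N] [Module R N] {j : N →ₗ[R] FractionRing R}

/-- The pairing of a module of multipliers of `N` with `N`, where `N` is embedded in the fraction
field by `j`. -/
noncomputable def multiplierToDual {S : Submodule R (FractionRing R)}
    (hS : ∀ x ∈ S, ∀ y, ∃ r, algebraMap R (FractionRing R) r = x * j y) : S →ₗ[R] Module.Dual R N :=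
  LinearMap.codRestrict₂ ((LinearMap.mul R (FractionRing R)).compl₁₂ S.subtype j)
    (Algebra.linearMap R (FractionRing R)) (IsFractionRing.injective R (FractionRing R))
    fun x y ↦ hS x x.2 y

theorem algebraMap_multiplierToDual {S : Submodule R (FractionRing R)}
    (hS : ∀ x ∈ S, ∀ y, ∃ r, algebraMap R (FractionRing R) r = x * j y) (x : S) (y : N) :
    algebraMap R (FractionRing R) (multiplierToDual hS x y) = x * j y :=
  LinearMap.codRestrict₂_apply ((LinearMap.mul R (FractionRing R)).compl₁₂ S.subtype j)
    (Algebra.linearMap R (FractionRing R)) (IsFractionRing.injective R (FractionRing R))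
    (fun x y ↦ hS x x.2 y) x y

variable [IsDomain R]

theorem mul_algebraMap_linearMap_comm (hj : Function.Injective j) (φ : N →ₗ[R] R) (x y : N) :
    j y * algebraMap R _ (φ x) = j x * algebraMap R _ (φ y) := by
  obtain ⟨⟨a, s⟩, ha⟩ := IsLocalization.surj R⁰ (j x)
  obtain ⟨⟨b, t⟩, hb⟩ := IsLocalization.surj R⁰ (j y)
  have hs := IsFractionRing.to_map_ne_zero_of_mem_nonZeroDivisors (K := FractionRing R) s.2
  have ht := IsFractionRing.to_map_ne_zero_of_mem_nonZeroDivisors (K := FractionRing R) t.2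
  have hsmul : (b * (s : R)) • x = (a * (t : R)) • y := by
    apply hj
    rw [map_smul, map_smul, Algebra.smul_def, Algebra.smul_def, map_mul, map_mul, ← ha, ← hb]
    ring
  have hφ := congrArg (algebraMap R (FractionRing R) ∘ φ) hsmul
  simp only [Function.comp_apply, map_smul, smul_eq_mul, map_mul, ← ha, ← hb] at hφ
  apply mul_right_cancel₀ (mul_ne_zero hs ht)
  linear_combination hφ

theorem exists_forall_algebraMap_eq_mul [Nontrivial N] (hj : Function.Injective j)
    (φ : N →ₗ[R] R) : ∃ x, ∀ y, algebraMap R (FractionRing R) (φ y) = x * j y := by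
  obtain ⟨z, hz⟩ := exists_ne (0 : N)
  have hz0 : j z ≠ 0 := (map_ne_zero_iff j hj).mpr hz
  refine ⟨algebraMap R _ (φ z) / j z, fun y ↦ ?_⟩
  rw [div_mul_eq_mul_div, eq_div_iff hz0, mul_comm, mul_comm _ (j y)]
  exact (mul_algebraMap_linearMap_comm hj φ z y).symm

/-- If `S` consists of all multipliers of `N` into `R`, then it is the dual of `N`. -/
noncomputable def multiplierEquivDual [Nontrivial N] (hj : Function.Injective j)
    {S : Submodule R (FractionRing R)}
    (hS : ∀ x, x ∈ S ↔ ∀ y, ∃ r, algebraMap R (FractionRing R) r = x * j y) :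
    S ≃ₗ[R] Module.Dual R N := by
  refine .ofBijective (multiplierToDual fun x ↦ (hS x).mp) ⟨fun x x' h ↦ ?_, fun φ ↦ ?_⟩
  · obtain ⟨z, hz⟩ := exists_ne (0 : N)
    have hxz := algebraMap_multiplierToDual (fun x ↦ (hS x).mp) x z
    rw [h, algebraMap_multiplierToDual] at hxz
    exact Subtype.ext (mul_right_cancel₀ ((map_ne_zero_iff j hj).mpr hz) hxz.symm)
  · obtain ⟨x, hx⟩ := exists_forall_algebraMap_eq_mul hj φ
    refine ⟨⟨x, (hS x).mpr fun y ↦ ⟨φ y, hx y⟩⟩, LinearMap.ext fun y ↦ ?_⟩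
    exact IsFractionRing.injective R (FractionRing R)
      ((algebraMap_multiplierToDual _ _ y).trans (hx y).symm)

theorem algebraMap_multiplierEquivDual [Nontrivial N] (hj : Function.Injective j)
    {S : Submodule R (FractionRing R)}
    (hS : ∀ x, x ∈ S ↔ ∀ y, ∃ r, algebraMap R (FractionRing R) r = x * j y) (x : S) (y : N) :
    algebraMap R (FractionRing R) (multiplierEquivDual hj hS x y) = x * j y :=
  algebraMap_multiplierToDual (fun x ↦ (hS x).mp) x y

end Multipliers

variable [IsDomain R]

namespace DivisorialIdeal

theorem divHull_mono {A B : FractionalIdeal R⁰ (FractionRing R)} (hA : A ≠ 0) (hB : B ≠ 0)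
    (h : A ≤ B) : A.divHull ≤ B.divHull :=
  inv_anti_mono (inv_ne_zero_of_ne_zero hB) (inv_ne_zero_of_ne_zero hA) (inv_anti_mono hA hB h)

theorem exists_ne_zero (D : DivisorialIdeal R) : ∃ x ∈ D.1, x ≠ 0 := by
  by_contra! h
  exact D.2.1 (FractionalIdeal.eq_zero_iff.mpr h)

/-- A divisorial ideal as a submodule of the fraction field; this is the module whose depth and
`Ext` groups are studied. -/
abbrev toSubmodule (D : DivisorialIdeal R) : Submodule R (FractionRing R) := D.1

instance (D : DivisorialIdeal R) : Nontrivial D.toSubmodule := by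
  obtain ⟨x, hx, hx0⟩ := D.exists_ne_zero
  exact ⟨⟨x, hx⟩, 0, fun h ↦ hx0 (congrArg Subtype.val h)⟩

variable [IsNoetherianRing R]

instance (D : DivisorialIdeal R) : Module.Finite R D.toSubmodule := by
  have := FractionalIdeal.isNoetherian D.1
  exact Module.IsNoetherian.finite R D.toSubmodule

variable [IsIntegrallyClosed R] {D E F : DivisorialIdeal R}

theorem mul_mem {x y : FractionRing R} (hx : x ∈ D.1) (hy : y ∈ E.1) : x * y ∈ (D * E).1 :=
  le_divHull (mul_ne_zero_of_ne_zero D.2.1 E.2.1) (mul_mem_mul hx hy)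

theorem mem_one {x : FractionRing R} :
    x ∈ (1 : DivisorialIdeal R).1 ↔ ∃ r : R, algebraMap R (FractionRing R) r = x := by
  rw [← mem_one_iff R⁰]
  change x ∈ (1 : FractionalIdeal R⁰ (FractionRing R)).divHull ↔ _
  rw [divHull, inv_one, inv_one]

theorem mem_principal {x : (FractionRing R)ˣ} {y : FractionRing R} :
    y ∈ (principal R x).1 ↔ ∃ r : R, r • (x : FractionRing R) = y :=
  mem_spanSingleton R⁰

theorem self_mem_principal (x : (FractionRing R)ˣ) : (x : FractionRing R) ∈ (principal R x).1 :=
  mem_spanSingleton_self R⁰ _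

theorem mul_le_iff : (D * E).1 ≤ F.1 ↔ ∀ x ∈ D.1, ∀ y ∈ E.1, x * y ∈ F.1 := by
  refine ⟨fun h x hx y hy ↦ h (mul_mem hx hy), fun h ↦ ?_⟩
  rw [← F.2.2]
  exact divHull_mono (mul_ne_zero_of_ne_zero D.2.1 E.2.1) F.2.1 (FractionalIdeal.mul_le.mpr h)

theorem mul_mono (h : D.1 ≤ E.1) (F : DivisorialIdeal R) : (D * F).1 ≤ (E * F).1 :=
  mul_le_iff.mpr fun _ hx _ hy ↦ mul_mem (h hx) hy

theorem mem_mul_inv_iff {x : FractionRing R} : x ∈ (D * E⁻¹).1 ↔ ∀ y ∈ E.1, x * y ∈ D.1 := by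
  refine ⟨fun hx y hy ↦ by simpa using mul_mem hx hy, fun h ↦ ?_⟩
  rcases eq_or_ne x 0 with rfl | hx
  · exact zero_mem _
  have hle : (principal R (Units.mk0 x hx) * E).1 ≤ D.1 := by
    refine mul_le_iff.mpr fun i hi y hy ↦ ?_
    obtain ⟨r, rfl⟩ := mem_principal.mp hi
    rw [smul_mul_assoc]
    exact Submodule.smul_mem D.toSubmodule r (h y hy)
  have hmul := mul_mono hle E⁻¹
  rw [mul_inv_cancel_right] at hmul
  exact hmul (self_mem_principal _)

theorem mem_inv_iff {x : FractionRing R} :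
    x ∈ (E⁻¹).1 ↔ ∀ y ∈ E.1, ∃ r : R, algebraMap R (FractionRing R) r = x * y := by
  rw [← one_mul E⁻¹, mem_mul_inv_iff]
  exact forall₂_congr fun y _ ↦ mem_one

/-- Multiplication by an element of `E` as a map from `D` to `F = D * E`. The product is given by
an equation, since `E` is often the inverse of a factor of `D` and `D * E` is not reduced. -/
noncomputable def mulMap (h : D * E = F) (x : FractionRing R) (hx : x ∈ E.1) :
    D.toSubmodule →ₗ[R] F.toSubmodule where
  toFun y := ⟨y * x, h ▸ mul_mem y.2 hx⟩
  map_add' _ _ := Subtype.ext (add_mul _ _ _)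
  map_smul' _ _ := Subtype.ext (smul_mul_assoc _ _ _)

theorem mulMap_apply (h : D * E = F) (x : FractionRing R) (hx : x ∈ E.1) (y : D.toSubmodule) :
    (mulMap h x hx y : FractionRing R) = y * x := rfl

theorem mulMap_injective (h : D * E = F) {x : FractionRing R} (hx : x ∈ E.1) (hx0 : x ≠ 0) :
    Function.Injective (mulMap h x hx) :=
  fun _ _ hyz ↦ Subtype.ext (mul_right_cancel₀ hx0 (congrArg Subtype.val hyz))

/-- Divisorial ideals in the same class are isomorphic, by multiplication in the fraction field. -/
noncomputable def mulPrincipalEquiv (D : DivisorialIdeal R) (x : (FractionRing R)ˣ) :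
    D.toSubmodule ≃ₗ[R] (D * principal R x).toSubmodule :=
  LinearEquiv.ofBijective (mulMap rfl x (self_mem_principal x)) ⟨mulMap_injective _ _ x.ne_zero,
    fun y ↦ ⟨mulMap (by rw [map_inv, mul_inv_cancel_right]) _ (self_mem_principal x⁻¹) y,
      Subtype.ext (x.inv_mul_cancel_right _)⟩⟩

theorem nonempty_linearEquiv_of_mk_eq (h : DivisorClassGroup.mk D = DivisorClassGroup.mk E) :
    Nonempty (D.toSubmodule ≃ₗ[R] E.toSubmodule) := by
  obtain ⟨x, hx⟩ := QuotientGroup.eq.mp (Additive.ofMul.injective h)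
  obtain rfl : D * principal R x = E := by rw [hx, mul_inv_cancel_left]
  exact ⟨mulPrincipalEquiv D x⟩

/-- The inverse of a divisorial ideal is its dual module. -/
noncomputable def invEquivDual (D : DivisorialIdeal R) :
    D⁻¹.toSubmodule ≃ₗ[R] Module.Dual R D.toSubmodule :=
  multiplierEquivDual D.toSubmodule.subtype_injective
    fun _ ↦ ⟨fun h y ↦ mem_inv_iff.mp h y y.2, fun h ↦ mem_inv_iff.mpr fun y hy ↦ h ⟨y, hy⟩⟩

theorem algebraMap_invEquivDual (D : DivisorialIdeal R) (x : D⁻¹.toSubmodule)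
    (y : D.toSubmodule) : algebraMap R (FractionRing R) (invEquivDual D x y) = x * y :=
  algebraMap_multiplierEquivDual _ _ x y

/-- The divisorial ideals that become principal at a prime `p`: some `u ∈ D` divides `D` up to a
multiplier `s ∉ p`. -/
def locallyPrincipal (p : Ideal R) [hp : p.IsPrime] : Subgroup (DivisorialIdeal R) where
  carrier := {D | ∃ u : FractionRing R, ∃ s : R, u ≠ 0 ∧ s ∉ p ∧ u ∈ D.1 ∧
    algebraMap R (FractionRing R) s / u ∈ (D⁻¹).1}
  mul_mem' := by
    rintro D E ⟨u, s, hu, hs, huD, hsD⟩ ⟨v, t, hv, ht, hvE, htE⟩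
    refine ⟨u * v, s * t, mul_ne_zero hu hv, fun h ↦ (hp.mem_or_mem h).elim hs ht,
      mul_mem huD hvE, ?_⟩
    rw [mul_inv, map_mul, mul_div_mul_comm]
    exact mul_mem hsD htE
  one_mem' := ⟨1, 1, one_ne_zero, p.one_notMem, mem_one.mpr ⟨1, map_one _⟩,
    by rw [inv_one]; exact mem_one.mpr ⟨1, by simp⟩⟩
  inv_mem' := by
    rintro D ⟨u, s, hu, hs, huD, hsD⟩
    have hs0 : algebraMap R (FractionRing R) s ≠ 0 :=
      (FaithfulSMul.algebraMap_eq_zero_iff R (FractionRing R)).not.mpr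
        (ne_of_mem_of_not_mem p.zero_mem hs).symm
    refine ⟨_, s, div_ne_zero hs0 hu, hs, hsD, ?_⟩
    rwa [inv_inv, div_div_cancel₀ hs0]

theorem exists_comp_eq_lsmul_of_mem_locallyPrincipal {p : Ideal R} [p.IsPrime]
    (hD : D ∈ locallyPrincipal p) (h : E * D = F) :
    ∃ (φ : E.toSubmodule →ₗ[R] F.toSubmodule) (ψ : F.toSubmodule →ₗ[R] E.toSubmodule) (s : R),
      s ∉ p ∧ φ ∘ₗ ψ = LinearMap.lsmul R _ s ∧ ψ ∘ₗ φ = LinearMap.lsmul R _ s := by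
  obtain ⟨u, s, hu, hs, huD, hsD⟩ := hD
  refine ⟨mulMap h u huD, mulMap (by rw [← h, mul_inv_cancel_right]) _ hsD, s, hs, ?_, ?_⟩ <;>
  · ext y
    simp only [LinearMap.comp_apply, mulMap_apply, LinearMap.lsmul_apply, Submodule.coe_smul,
      Algebra.smul_def]
    field_simp

end DivisorialIdeal

end Divisorial

section IdealHull

open FractionalIdeal IsLocalRing

variable {R : Type u} [CommRing R]

theorem exists_notMem_forall_smul_mem {M : Type*} [AddCommGroup M] [Module R M] [Module.Finite R M]
    {p : Ideal R} [p.IsPrime] {P : Submodule R M} (h : ∀ m, ∃ s ∉ p, s • m ∈ P) :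
    ∃ s ∉ p, ∀ m, s • m ∈ P := by
  have hsupp : (⟨p, inferInstance⟩ : PrimeSpectrum R) ∉ Module.support R (M ⧸ P) := by
    rw [Module.notMem_support_iff']
    intro m
    obtain ⟨m, rfl⟩ := P.mkQ_surjective m
    obtain ⟨s, hs, hm⟩ := h m
    exact ⟨s, hs, (map_smul P.mkQ s m).symm.trans ((Submodule.Quotient.mk_eq_zero P).mpr hm)⟩
  rw [Module.mem_support_iff_of_finite, SetLike.not_le_iff_exists] at hsupp
  obtain ⟨s, hs, hsp⟩ := hsupp
  exact ⟨s, hsp, fun m ↦ (Submodule.Quotient.mk_eq_zero P).mp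
    ((map_smul P.mkQ s m).trans (Module.mem_annihilator.mp hs _))⟩

variable [IsDomain R] {I : Ideal R}

theorem nontrivial_localizedModule_of_ne_bot (hI : I ≠ ⊥) (p : Ideal R) [p.IsPrime] :
    Nontrivial (LocalizedModule p.primeCompl I) := by
  obtain ⟨x, hx, hx0⟩ := Submodule.exists_mem_ne_zero_of_ne_bot hI
  refine ⟨LocalizedModule.mkLinearMap p.primeCompl I ⟨x, hx⟩, 0, fun h ↦ ?_⟩
  obtain ⟨s, hs⟩ := (IsLocalizedModule.eq_zero_iff p.primeCompl _).mp h
  rcases mul_eq_zero.mp (congrArg Subtype.val hs) with h | h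
  · exact ne_of_mem_of_not_mem p.zero_mem s.2 h.symm
  · exact hx0 h

theorem exists_forall_smul_mem_span_of_free (hI : I ≠ ⊥) (p : Ideal R) [p.IsPrime]
    [Module.Free (Localization.AtPrime p) (LocalizedModule p.primeCompl I)] :
    ∃ y : I, ∀ x : I, ∃ s ∉ p, s • x ∈ Submodule.span R {y} := by
  have := nontrivial_localizedModule_of_ne_bot hI p
  let b := Module.Free.chooseBasis (Localization.AtPrime p) (LocalizedModule p.primeCompl I)
  let g := LocalizedModule.mkLinearMap p.primeCompl I
  obtain ⟨i⟩ := b.index_nonempty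
  obtain ⟨⟨y, t⟩, hy⟩ := IsLocalizedModule.surj p.primeCompl g (b i)
  refine ⟨y, fun x ↦ ?_⟩
  obtain ⟨⟨r, s⟩, hr⟩ := IsLocalization.surj p.primeCompl (b.coord i (g x))
  refine ⟨s * t, (s * t).2, Submodule.mem_span_singleton.mpr ⟨r, Subtype.ext ?_⟩⟩
  -- Taking coordinates in `x • g y = y • g x` shows that `x` is a multiple of `y` locally at `p`.
  have hcomm : (x : R) • g y = (y : R) • g x := by
    rw [← map_smul, ← map_smul]
    exact congrArg g (Subtype.ext (mul_comm _ _))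
  have hcoord := congrArg (b.coord i) hcomm
  rw [← hy, Submonoid.smul_def, ← algebraMap_smul (Localization.AtPrime p),
    ← algebraMap_smul (Localization.AtPrime p) (t : R),
    ← algebraMap_smul (Localization.AtPrime p) (y : R), map_smul, map_smul, map_smul] at hcoord
  simp only [Module.Basis.coord_apply, Module.Basis.repr_self, Finsupp.single_eq_same, smul_eq_mul,
    mul_one] at hcoord hr
  apply IsLocalization.injective (Localization.AtPrime p) p.primeCompl_le_nonZeroDivisors
  simp only [Submodule.coe_smul, smul_eq_mul, map_mul, ← hr]
  linear_combination -algebraMap R (Localization.AtPrime p) s * hcoord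

namespace DivisorialIdeal

/-- The divisorial hull of a nonzero ideal. -/
noncomputable abbrev ofIdeal (I : Ideal R) (hI : I ≠ ⊥) : DivisorialIdeal R :=
  mk (I : FractionalIdeal R⁰ (FractionRing R)) (coeIdeal_ne_zero.mpr hI)

theorem algebraMap_mem_ofIdeal (hI : I ≠ ⊥) {x : R} (hx : x ∈ I) :
    algebraMap R (FractionRing R) x ∈ (ofIdeal I hI).1 :=
  le_divHull (coeIdeal_ne_zero.mpr hI) (mem_coeIdeal_of_mem _ hx)

variable [IsNoetherianRing R] [IsIntegrallyClosed R]

theorem mem_ofIdeal_inv_iff (hI : I ≠ ⊥) {x : FractionRing R} : x ∈ ((ofIdeal I hI)⁻¹).1 ↔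
    ∀ y : I, ∃ r, algebraMap R (FractionRing R) r = x * algebraMap R _ (y : R) := by
  have h0 := coeIdeal_ne_zero (K := FractionRing R).mpr hI
  have hinv : ((ofIdeal I hI)⁻¹).1 = (I : FractionalIdeal R⁰ (FractionRing R))⁻¹ := by
    change ((I : FractionalIdeal R⁰ (FractionRing R)).divHull⁻¹).divHull = _
    rw [inv_divHull h0]
    exact inv_divHull h0
  rw [hinv, FractionalIdeal.mem_inv_iff h0]
  constructor
  · exact fun h y ↦ (mem_one_iff _).mp (h _ (mem_coeIdeal_of_mem _ y.2))
  · rintro h _ hy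
    obtain ⟨y, hyI, rfl⟩ := (mem_coeIdeal _).mp hy
    exact (mem_one_iff _).mpr (h ⟨y, hyI⟩)

theorem one_mem_ofIdeal_inv (hI : I ≠ ⊥) : (1 : FractionRing R) ∈ ((ofIdeal I hI)⁻¹).1 :=
  (mem_ofIdeal_inv_iff hI).mpr fun y ↦ ⟨y, (one_mul _).symm⟩

/-- The inverse of the divisorial hull of an ideal `I` is the dual of `I`. -/
noncomputable def ofIdealInvEquivDual (hI : I ≠ ⊥) :
    (ofIdeal I hI)⁻¹.toSubmodule ≃ₗ[R] Module.Dual R I :=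
  have := Submodule.nontrivial_iff_ne_bot.mpr hI
  multiplierEquivDual (j := Algebra.linearMap R (FractionRing R) ∘ₗ I.subtype)
    ((IsFractionRing.injective R (FractionRing R)).comp I.subtype_injective)
    fun _ ↦ mem_ofIdeal_inv_iff hI

theorem algebraMap_ofIdealInvEquivDual (hI : I ≠ ⊥) (x : (ofIdeal I hI)⁻¹.toSubmodule) (y : I) :
    algebraMap R (FractionRing R) (ofIdealInvEquivDual hI x y) = x * algebraMap R _ (y : R) :=
  have := Submodule.nontrivial_iff_ne_bot.mpr hI
  algebraMap_multiplierEquivDual (j := Algebra.linearMap R (FractionRing R) ∘ₗ I.subtype)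
    ((IsFractionRing.injective R (FractionRing R)).comp I.subtype_injective)
    (fun _ ↦ mem_ofIdeal_inv_iff hI) x y

theorem ofIdealInvEquivDual_one (hI : I ≠ ⊥) :
    ofIdealInvEquivDual hI ⟨1, one_mem_ofIdeal_inv hI⟩ = I.subtype :=
  LinearMap.ext fun y ↦ IsFractionRing.injective R (FractionRing R)
    ((algebraMap_ofIdealInvEquivDual hI _ y).trans (one_mul _))

theorem ofIdeal_mem_locallyPrincipal (hI : I ≠ ⊥) (p : Ideal R) [p.IsPrime]
    [Module.Free (Localization.AtPrime p) (LocalizedModule p.primeCompl I)] :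
    ofIdeal I hI ∈ locallyPrincipal p := by
  obtain ⟨y, hy⟩ := exists_forall_smul_mem_span_of_free hI p
  obtain ⟨s, hsp, hs⟩ := exists_notMem_forall_smul_mem hy
  simp only [Submodule.mem_span_singleton, Subtype.ext_iff, Submodule.coe_smul, smul_eq_mul] at hs
  have hy0 : algebraMap R (FractionRing R) y ≠ 0 := by
    rw [Ne, FaithfulSMul.algebraMap_eq_zero_iff]
    intro hy0
    obtain ⟨x, hx, hx0⟩ := Submodule.exists_mem_ne_zero_of_ne_bot hI
    obtain ⟨r, hr⟩ := hs ⟨x, hx⟩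
    rw [hy0, mul_zero, zero_eq_mul, or_iff_left hx0] at hr
    exact ne_of_mem_of_not_mem p.zero_mem hsp hr.symm
  refine ⟨algebraMap R _ y, s, hy0, hsp, algebraMap_mem_ofIdeal hI y.2,
    (mem_ofIdeal_inv_iff hI).mpr fun x ↦ ?_⟩
  obtain ⟨r, hr⟩ := hs x
  exact ⟨r, by rw [div_mul_eq_mul_div, eq_div_iff hy0, ← map_mul, ← map_mul, hr]⟩

variable [IsLocalRing R] {d : ℕ}

theorem mem_ofIdeal_iff (hR : IsGorensteinOfDim R d) (hI : I ≠ ⊥) (hIgor : I.IsGorenstein)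
    (hI1 : I.height = 1) {x : FractionRing R} :
    x ∈ (ofIdeal I hI).1 ↔ ∃ y ∈ I, algebraMap R _ y = x := by
  refine ⟨fun hx ↦ ?_, fun ⟨y, hy, h⟩ ↦ h ▸ algebraMap_mem_ofIdeal hI hy⟩
  have hx' : x ∈ ((ofIdeal I hI)⁻¹⁻¹).toSubmodule := by rwa [inv_inv]
  let ψ := invEquivDual (ofIdeal I hI)⁻¹ ⟨x, hx'⟩
  obtain ⟨y, hy⟩ := hR.bidual_surjective (hR.hasNoHigherExt_ideal hIgor hI1)
    (ψ ∘ₗ (ofIdealInvEquivDual hI).symm)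
  refine ⟨y, y.2, ?_⟩
  have hyψ : (y : R) = ψ ⟨1, one_mem_ofIdeal_inv hI⟩ := by
    have hy1 := LinearMap.congr_fun hy I.subtype
    rwa [LinearMap.comp_apply, LinearEquiv.coe_coe, ← ofIdealInvEquivDual_one hI,
      LinearEquiv.symm_apply_apply, Module.Dual.eval_apply, ofIdealInvEquivDual_one] at hy1
  rw [hyψ, algebraMap_invEquivDual, mul_one]

theorem hasNoHigherExt_ofIdeal (hR : IsGorensteinOfDim R d) (hI : I ≠ ⊥) (hIgor : I.IsGorenstein)
    (hI1 : I.height = 1) : HasNoHigherExt R (ofIdeal I hI).toSubmodule R := by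
  let ι : I →ₗ[R] (ofIdeal I hI).toSubmodule :=
    (Algebra.linearMap R (FractionRing R) ∘ₗ I.subtype).codRestrict _
      fun y ↦ algebraMap_mem_ofIdeal hI y.2
  have hι : Function.Bijective ι := by
    refine ⟨fun y z h ↦ Subtype.ext ?_, fun x ↦ ?_⟩
    · exact IsFractionRing.injective R (FractionRing R) (congrArg Subtype.val h)
    · obtain ⟨y, hy, h⟩ := (mem_ofIdeal_iff hR hI hIgor hI1).mp x.2
      exact ⟨⟨y, hy⟩, Subtype.ext h⟩
  exact fun j hj ↦ (ModuleExt.subsingleton_congr_left j (LinearEquiv.ofBijective ι hι)).mp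
    (hR.hasNoHigherExt_ideal hIgor hI1 j hj)

theorem isPrincipal_of_ofIdeal_mem_range_principal (hR : IsGorensteinOfDim R d) (hI : I ≠ ⊥)
    (hIgor : I.IsGorenstein) (hI1 : I.height = 1)
    (h : ofIdeal I hI ∈ (principal R).range) : I.IsPrincipal := by
  obtain ⟨x, hx⟩ := h
  obtain ⟨a, ha, hax⟩ := (mem_ofIdeal_iff hR hI hIgor hI1).mp (hx ▸ self_mem_principal x)
  refine ⟨a, le_antisymm (fun y hy ↦ ?_) ((Ideal.span_singleton_le_iff_mem I).mpr ha)⟩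
  obtain ⟨r, hr⟩ := mem_principal.mp (hx ▸ algebraMap_mem_ofIdeal hI hy)
  rw [← hax, Algebra.smul_def, ← map_mul] at hr
  exact Submodule.mem_span_singleton.mpr ⟨r, IsFractionRing.injective R (FractionRing R) hr⟩

end DivisorialIdeal

end IdealHull

section FiniteLength

open IsLocalRing

variable {R : Type u} [CommRing R]

theorem length_ne_top_of_maximalIdeal_le_radical_annihilator [IsNoetherianRing R] [IsLocalRing R]
    {M : Type*} [AddCommGroup M] [Module R M] [Module.Finite R M]
    (hM : maximalIdeal R ≤ (Module.annihilator R M).radical) : Module.length R M ≠ ⊤ := by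
  rcases subsingleton_or_nontrivial M with hM0 | hM0
  · simp [Module.length_eq_zero]
  have hdim := ringKrullDim_quotient_eq_zero
    (le_maximalIdeal (Module.annihilator_eq_top_iff.not.mpr (not_subsingleton M))) hM
  have : Ring.KrullDimLE 0 (R ⧸ Module.annihilator R M) := Ring.krullDimLE_iff.mpr hdim.le
  have : IsArtinianRing (R ⧸ Module.annihilator R M) :=
    IsNoetherianRing.isArtinianRing_of_krullDimLE_zero
  let : Module (R ⧸ Module.annihilator R M) M := Module.quotientAnnihilator
  have : IsScalarTower R (R ⧸ Module.annihilator R M) M := ⟨fun r a m ↦ by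
    obtain ⟨a, rfl⟩ := Ideal.Quotient.mk_surjective a
    exact mul_smul r a m⟩
  have : Module.Finite (R ⧸ Module.annihilator R M) M := .of_restrictScalars_finite R _ M
  rw [Module.length_eq_of_surjective (R := R ⧸ Module.annihilator R M)
    Ideal.Quotient.mk_surjective]
  exact Module.length_ne_top

theorem length_le_add_of_exact {M N P : Type*} [AddCommGroup M] [Module R M] [AddCommGroup N]
    [Module R N] [AddCommGroup P] [Module R P] {f : M →ₗ[R] N} {g : N →ₗ[R] P}
    (h : Function.Exact f g) : Module.length R N ≤ Module.length R M + Module.length R P := by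
  have hg : Function.Exact (LinearMap.ker g).subtype g.rangeRestrict := fun y ↦ by
    rw [← LinearMap.mem_ker, LinearMap.ker_rangeRestrict]
    exact (LinearMap.exact_subtype_ker_map g) y
  rw [Module.length_eq_add_of_exact _ _ (Submodule.subtype_injective _)
    g.surjective_rangeRestrict hg, LinearMap.exact_iff.mp h]
  exact add_le_add (Module.length_le_of_surjective _ f.surjective_rangeRestrict)
    (Module.length_le_of_injective _ (Submodule.subtype_injective _))

namespace ModuleExt

variable {M N P Y : Type u} [AddCommGroup M] [Module R M] [AddCommGroup N] [Module R N]
  [AddCommGroup P] [Module R P] [AddCommGroup Y] [Module R Y]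

theorem length_add_le_length_prod (n : ℕ) :
    Module.length R (ModuleExt R M Y n) + Module.length R (ModuleExt R N Y n) ≤
      Module.length R (ModuleExt R (M × N) Y n) :=
  (Module.length_prod ..).symm.trans_le
    (Module.length_le_of_surjective _ (prod_precomp_inl_inr_surjective n))

theorem exact_precomp_of_subsingleton {f : M →ₗ[R] N} {g : N →ₗ[R] P}
    (hf : Function.Injective f) (hfg : Function.Exact f g) (n : ℕ)
    (hC : Subsingleton (ModuleExt R (P ⧸ LinearMap.range g) Y (n + 1))) :
    Function.Exact (precomp Y g n) (precomp Y f n) := by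
  have hcomp : precomp Y g n =
      precomp Y g.rangeRestrict n ∘ₗ precomp Y (LinearMap.range g).subtype n :=
    precomp_comp n g.rangeRestrict (LinearMap.range g).subtype
  have hsurj := (IsShortExact.subtype_mkQ (LinearMap.range g)).precomp_surjective Y n hC
  rw [hcomp]
  exact hsurj.comp_exact_iff_exact.mpr ((IsShortExact.rangeRestrict hf hfg).exact_precomp Y n)

end ModuleExt

theorem eq_zero_of_two_mul_le {ℓ : ℤ → ℕ} (h : ∀ i, 2 * ℓ i ≤ ℓ (i - 1) + ℓ (i + 1)) {a b i : ℤ}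
    (ha : ℓ a = 0) (hb : ℓ b = 0) (hai : a ≤ i) (hib : i ≤ b) : ℓ i = 0 := by
  -- By convexity `ℓ` cannot decrease to the right of its minimum `ℓ a = 0`.
  have hstep (k : ℤ) (hk : a ≤ k) : ℓ k ≤ ℓ (k + 1) := by
    induction k, hk using Int.leInduction with
    | base => exact ha ▸ Nat.zero_le _
    | succ k _ ih =>
      have hk := h (k + 1)
      rw [add_sub_cancel_right] at hk
      lia
  have hle : ℓ i ≤ ℓ b := by
    clear hb
    induction b, hib using Int.leInduction with
    | base => exact le_rfl
    | succ k hk ih => exact ih.trans (hstep k (hai.trans hk))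
  exact Nat.le_zero.mp (hb ▸ hle)

end FiniteLength

section TwoGeneratedInverse

open IsLocalRing

variable {R : Type u} [CommRing R] [IsDomain R] [IsNoetherianRing R] [IsIntegrallyClosed R]

namespace DivisorialIdeal

variable {D E F L L' L'' : DivisorialIdeal R} {f : FractionRing R}

/-- The elements `1` and `f` generate the inverse of `D`. -/
structure IsInvGenerator (D : DivisorialIdeal R) (f : FractionRing R) : Prop where
  one_mem : 1 ∈ (D⁻¹).1
  mem : f ∈ (D⁻¹).1
  exists_eq : ∀ x ∈ (D⁻¹).1, ∃ a b : R, x = algebraMap R _ a + algebraMap R _ b * f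

namespace IsInvGenerator

variable (h : IsInvGenerator D f) (hL' : L * D = L') (hL'' : L * D⁻¹ = L'')

/-- The map `b ↦ (-f b, b)` from `L * D` to `L × L`. -/
noncomputable def left : L'.toSubmodule →ₗ[R] L.toSubmodule × L.toSubmodule :=
  (-(mulMap (by rw [← hL', mul_inv_cancel_right]) f h.mem)).prod
    (mulMap (by rw [← hL', mul_inv_cancel_right]) 1 h.one_mem)

/-- The map `(a, b) ↦ a + f b` from `L × L` to `L * D⁻¹`. -/
noncomputable def right : L.toSubmodule × L.toSubmodule →ₗ[R] L''.toSubmodule :=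
  (mulMap hL'' 1 h.one_mem).coprod (mulMap hL'' f h.mem)

theorem right_apply (x : L.toSubmodule × L.toSubmodule) :
    (h.right hL'' x : FractionRing R) = x.1 + x.2 * f := by
  change (x.1 : FractionRing R) * 1 + x.2 * f = _
  rw [mul_one]

theorem left_injective : Function.Injective (h.left hL') := fun _ _ hxy ↦
  mulMap_injective _ h.one_mem one_ne_zero (congrArg Prod.snd hxy)

include h hL' in
theorem mem_of_add_mul_eq_zero {a b : L.toSubmodule} (hab : (a : FractionRing R) + b * f = 0) :
    (b : FractionRing R) ∈ L'.1 := by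
  rw [← hL', ← inv_inv D, mem_mul_inv_iff]
  intro y hy
  obtain ⟨r, s, rfl⟩ := h.exists_eq y hy
  have hby : (b : FractionRing R) * (algebraMap R _ r + algebraMap R _ s * f) =
      ((r • b - s • a : L.toSubmodule) : FractionRing R) := by
    rw [Submodule.coe_sub, Submodule.coe_smul, Submodule.coe_smul, Algebra.smul_def,
      Algebra.smul_def]
    linear_combination algebraMap R _ s * hab
  exact hby ▸ (r • b - s • a).2

theorem exact : Function.Exact (h.left hL') (h.right hL'') := by
  rintro ⟨a, b⟩
  constructor
  · intro hab
    have hrel : (a : FractionRing R) + b * f = 0 :=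
      (h.right_apply hL'' (a, b)).symm.trans (congrArg Subtype.val hab)
    refine ⟨⟨b, h.mem_of_add_mul_eq_zero hL' hrel⟩,
      Prod.ext (Subtype.ext ?_) (Subtype.ext (mul_one _))⟩
    change -((b : FractionRing R) * f) = a
    linear_combination -hrel
  · rintro ⟨b, hb⟩
    rw [← hb]
    apply Subtype.ext
    rw [right_apply]
    change -((b : FractionRing R) * f) + b * 1 * f = 0
    ring

theorem exists_smul_mem_range (p : Ideal R) [p.IsPrime] (hp : D ∈ locallyPrincipal p) :
    ∃ s ∉ p, ∀ y : L''.toSubmodule, s • y ∈ LinearMap.range (h.right hL'') := by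
  obtain ⟨u, s, hu, hs, huD, hsD⟩ := hp
  refine ⟨s, hs, fun y ↦ ?_⟩
  obtain ⟨a, b, hab⟩ := h.exists_eq _ hsD
  have hy : (y : FractionRing R) * u ∈ L.1 := by
    have hL : L'' * D = L := by rw [← hL'', inv_mul_cancel_right]
    exact hL ▸ mul_mem y.2 huD
  refine ⟨(a • ⟨_, hy⟩, b • ⟨_, hy⟩), Subtype.ext ?_⟩
  rw [right_apply, Submodule.coe_smul, Submodule.coe_smul, Submodule.coe_smul, Algebra.smul_def,
    Algebra.smul_def, Algebra.smul_def]
  rw [div_eq_iff hu] at hab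
  linear_combination -(y : FractionRing R) * hab

end IsInvGenerator

variable [IsLocalRing R]

/-- A divisorial ideal that is principal at every nonmaximal prime ideal. -/
def IsPuncturedLocallyPrincipal (D : DivisorialIdeal R) : Prop :=
  ∀ (p : Ideal R) [p.IsPrime], p ≠ maximalIdeal R → D ∈ locallyPrincipal p

theorem IsPuncturedLocallyPrincipal.zpow (hD : D.IsPuncturedLocallyPrincipal) (n : ℤ) :
    (D ^ n).IsPuncturedLocallyPrincipal :=
  fun p _ hp ↦ Subgroup.zpow_mem _ (hD p hp) n

theorem IsPuncturedLocallyPrincipal.maximalIdeal_le_radical_annihilator_ext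
    (hD : D.IsPuncturedLocallyPrincipal) (hF : E * D = F) {Y : Type u} [AddCommGroup Y]
    [Module R Y] (j : ℕ) (hE : Subsingleton (ModuleExt R E.toSubmodule Y j)) :
    maximalIdeal R ≤ (Module.annihilator R (ModuleExt R F.toSubmodule Y j)).radical := by
  refine maximalIdeal_le_radical_of_forall_isPrime fun p hp hle ↦ ?_
  by_contra hpm
  obtain ⟨φ, ψ, s, hs, hφψ, -⟩ := exists_comp_eq_lsmul_of_mem_locallyPrincipal (hD p hpm) hF
  refine hs (hle (Module.mem_annihilator.mpr fun y ↦ ?_))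
  rw [← ModuleExt.precomp_lsmul, ← hφψ, ModuleExt.precomp_comp, LinearMap.comp_apply,
    Subsingleton.elim (ModuleExt.precomp Y φ j y) 0, map_zero]

theorem IsInvGenerator.maximalIdeal_le_radical_annihilator_quotient_range
    (h : IsInvGenerator D f) (hL'' : L * D⁻¹ = L'') (hD : D.IsPuncturedLocallyPrincipal) :
    maximalIdeal R ≤
      (Module.annihilator R (L''.toSubmodule ⧸ LinearMap.range (h.right hL''))).radical := by
  refine maximalIdeal_le_radical_of_forall_isPrime fun p hp hle ↦ ?_
  by_contra hpm
  obtain ⟨s, hs, hrange⟩ := h.exists_smul_mem_range hL'' p (hD p hpm)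
  refine hs (hle (Module.mem_annihilator.mpr fun y ↦ ?_))
  obtain ⟨y, rfl⟩ := Submodule.mkQ_surjective _ y
  rw [← map_smul, Submodule.mkQ_apply, Submodule.Quotient.mk_eq_zero]
  exact hrange y

variable {d : ℕ}

theorem exists_isInvGenerator_ofIdeal (hR : IsGorensteinOfDim R d) {I : Ideal R} (hI : I ≠ ⊥)
    (hIgor : I.IsGorenstein) (hI1 : I.height = 1) : ∃ f, IsInvGenerator (ofIdeal I hI) f := by
  obtain ⟨φ, hφ⟩ := hR.exists_dual_generator hIgor hI1
  let e := ofIdealInvEquivDual hI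
  refine ⟨e.symm φ, one_mem_ofIdeal_inv hI, (e.symm φ).2, fun x hx ↦ ?_⟩
  obtain ⟨a, b, hab⟩ := hφ (e ⟨x, hx⟩)
  have hx' : (⟨x, hx⟩ : (ofIdeal I hI)⁻¹.toSubmodule) =
      a • ⟨1, one_mem_ofIdeal_inv hI⟩ + b • e.symm φ := by
    apply e.injective
    rw [hab, map_add, map_smul, map_smul, ofIdealInvEquivDual_one, e.apply_symm_apply]
  refine ⟨a, b, (congrArg Subtype.val hx').trans ?_⟩
  rw [Submodule.coe_add, Submodule.coe_smul, Submodule.coe_smul, Algebra.smul_def,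
    Algebra.smul_def, mul_one]

theorem two_le_moduleDepth (hR : IsGorensteinOfDim R d) (hd : 2 ≤ d) (D : DivisorialIdeal R) :
    2 ≤ moduleDepth R D.toSubmodule := by
  rw [← inv_inv D, moduleDepth_congr (invEquivDual D⁻¹)]
  exact hR.two_le_moduleDepth_dual hd _

theorem natCast_le_moduleDepth_inv (hR : IsGorensteinOfDim R d)
    (hD : HasNoHigherExt R D.toSubmodule R) : (d : ℕ∞) ≤ moduleDepth R D⁻¹.toSubmodule := by
  rw [moduleDepth_congr (invEquivDual D)]
  exact hR.natCast_le_moduleDepth_dual hD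

theorem natCast_le_moduleDepth (hR : IsGorensteinOfDim R d)
    (hD : HasNoHigherExt R D.toSubmodule R) : (d : ℕ∞) ≤ moduleDepth R D.toSubmodule := by
  rw [← inv_inv D]
  exact natCast_le_moduleDepth_inv hR
    (hR.hasNoHigherExt_of_natCast_le_moduleDepth (natCast_le_moduleDepth_inv hR hD))

theorem IsInvGenerator.two_mul_length_ext_le (h : IsInvGenerator D f)
    (hR : IsGorensteinOfDim R d) (hD : D.IsPuncturedLocallyPrincipal) (hL' : L * D = L')
    (hL'' : L * D⁻¹ = L'') {j : ℕ} (hj : j + 1 < d) :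
    2 * Module.length R (ModuleExt R L.toSubmodule R j) ≤
      Module.length R (ModuleExt R L''.toSubmodule R j) +
        Module.length R (ModuleExt R L'.toSubmodule R j) := by
  rw [two_mul]
  refine (ModuleExt.length_add_le_length_prod j).trans (length_le_add_of_exact
    (ModuleExt.exact_precomp_of_subsingleton (h.left_injective hL') (h.exact hL' hL'') j ?_))
  exact hR.subsingleton_ext_of_lt
    (h.maximalIdeal_le_radical_annihilator_quotient_range hL'' hD) (j + 1) hj

theorem IsPuncturedLocallyPrincipal.length_ext_ne_top (hD : D.IsPuncturedLocallyPrincipal)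
    (hF : E * D = F) (j : ℕ) (hE : Subsingleton (ModuleExt R E.toSubmodule R j)) :
    Module.length R (ModuleExt R F.toSubmodule R j) ≠ ⊤ :=
  have : Module.Finite R (ModuleExt R F.toSubmodule R j) := ModuleCat.finite_ext ..
  length_ne_top_of_maximalIdeal_le_radical_annihilator
    (hD.maximalIdeal_le_radical_annihilator_ext hF j hE)

theorem IsInvGenerator.hasNoHigherExt_mul_zpow (h : IsInvGenerator D f)
    (hR : IsGorensteinOfDim R d) (hd : 2 ≤ d) (hD : D.IsPuncturedLocallyPrincipal) {a b i : ℤ}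
    (ha : HasNoHigherExt R (E * D ^ a).toSubmodule R)
    (hb : HasNoHigherExt R (E * D ^ b).toSubmodule R) (hai : a ≤ i) (hib : i ≤ b) :
    HasNoHigherExt R (E * D ^ i).toSubmodule R := by
  intro j hj
  by_cases! hjd : d ≤ j + 1
  · exact hR.subsingleton_ext_of_natCast_le_moduleDepth
      (by exact_mod_cast two_le_moduleDepth hR hd _) j (r := 2) (by omega)
  have hfin (k : ℤ) : Module.length R (ModuleExt R (E * D ^ k).toSubmodule R j) ≠ ⊤ :=
    (hD.zpow (k - a)).length_ext_ne_top (by rw [mul_assoc, ← zpow_add, add_sub_cancel]) j (ha j hj)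
  choose ℓ hℓ using fun k ↦ ENat.ne_top_iff_exists.mp (hfin k)
  have hconvex (k : ℤ) : 2 * ℓ k ≤ ℓ (k - 1) + ℓ (k + 1) := by
    have hlength := h.two_mul_length_ext_le (L := E * D ^ k) (L' := E * D ^ (k + 1))
      (L'' := E * D ^ (k - 1)) hR hD (by rw [mul_assoc, zpow_add_one])
      (by rw [mul_assoc, zpow_sub_one]) hjd
    rw [← hℓ, ← hℓ, ← hℓ] at hlength
    exact_mod_cast hlength
  have hzero (k : ℤ) : ℓ k = 0 ↔ Subsingleton (ModuleExt R (E * D ^ k).toSubmodule R j) := by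
    rw [← Module.length_eq_zero_iff (R := R), ← hℓ, Nat.cast_eq_zero]
  exact (hzero i).mp
    (eq_zero_of_two_mul_le hconvex ((hzero a).mpr (ha j hj)) ((hzero b).mpr (hb j hj)) hai hib)

theorem IsPuncturedLocallyPrincipal.isMaximalCohenMacaulay_mul_zpow
    (hD : D.IsPuncturedLocallyPrincipal) (hR : IsGorensteinOfDim R d) {n i : ℤ}
    (hn : IsMaximalCohenMacaulay R (E * D ^ n).toSubmodule)
    (hi : HasNoHigherExt R (E * D ^ i).toSubmodule R) :
    IsMaximalCohenMacaulay R (E * D ^ i).toSubmodule := by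
  refine isMaximalCohenMacaulay_of_natCast_le_moduleDepth hR.ringKrullDim_eq
    (natCast_le_moduleDepth hR hi) fun p _ hp ↦ (hn.2 p).trans_eq ?_
  have hmul : E * D ^ n * D ^ (i - n) = E * D ^ i := by
    rw [mul_assoc, ← zpow_add, add_sub_cancel]
  obtain ⟨φ, ψ, s, hs, hφψ, hψφ⟩ :=
    exists_comp_eq_lsmul_of_mem_locallyPrincipal (hD.zpow (i - n) p hp) hmul
  exact moduleDepth_localizedModule_congr hs hφψ hψφ

theorem IsInvGenerator.isMaximalCohenMacaulay_mul_zpow (h : IsInvGenerator D f)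
    (hR : IsGorensteinOfDim R d) (hd : 2 ≤ d) (hD : D.IsPuncturedLocallyPrincipal)
    (hE : HasNoHigherExt R E.toSubmodule R) {n i : ℤ}
    (hn : IsMaximalCohenMacaulay R (E * D ^ n).toSubmodule)
    (hi : (0 ≤ i ∧ i ≤ n) ∨ (n ≤ i ∧ i ≤ 0)) :
    IsMaximalCohenMacaulay R (E * D ^ i).toSubmodule := by
  have hzero : HasNoHigherExt R (E * D ^ (0 : ℤ)).toSubmodule R := by rwa [zpow_zero, mul_one]
  have hpow : HasNoHigherExt R (E * D ^ n).toSubmodule R :=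
    hR.hasNoHigherExt_of_natCast_le_moduleDepth (hn.natCast_le_moduleDepth hR.ringKrullDim_eq)
  refine hD.isMaximalCohenMacaulay_mul_zpow hR hn ?_
  rcases hi with ⟨hi0, hin⟩ | ⟨hni, hi0⟩
  · exact h.hasNoHigherExt_mul_zpow hR hd hD hzero hpow hi0 hin
  · exact h.hasNoHigherExt_mul_zpow hR hd hD hpow hzero hni hi0

end DivisorialIdeal

end TwoGeneratedInverse

section TwoGenerated

open IsLocalRing

variable {R : Type u} [CommRing R]

section Acyclicity

variable [IsLocalRing R] {M N P : Type u} [AddCommGroup M] [Module R M] [AddCommGroup N]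
  [Module R N] [AddCommGroup P] [Module R P]

theorem natCast_le_moduleDepth_prod [IsNoetherianRing R] [Module.Finite R M] [Module.Finite R N]
    {n : ℕ} (hM : (n : ℕ∞) ≤ moduleDepth R M) (hN : (n : ℕ∞) ≤ moduleDepth R N) :
    (n : ℕ∞) ≤ moduleDepth R (M × N) :=
  natCast_le_moduleDepth_iff_subsingleton_ext.mpr fun i hi ↦
    IsShortExact.inl_snd.subsingleton_ext_to_middle _ i
      (subsingleton_ext_residueField_of_natCast_le_moduleDepth hM i hi)
      (subsingleton_ext_residueField_of_natCast_le_moduleDepth hN i hi)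

theorem subsingleton_of_subsingleton_ext_residueField [IsNoetherianRing R]
    (hM : maximalIdeal R ≤ (Module.annihilator R M).radical)
    (h : Subsingleton (ModuleExt R (R ⧸ maximalIdeal R) M 0)) : Subsingleton M := by
  by_contra! hne
  obtain ⟨a, ha0, ha⟩ := exists_socle_element M hM
  obtain ⟨φ, -, hφ⟩ := exists_injective_of_residueField ha0 ha
  have hφ0 : φ = 0 := (ModuleExt.homEquiv R _ M).injective (Subsingleton.elim _ _)
  rw [← hφ, hφ0, LinearMap.zero_apply] at ha0
  exact ha0 rfl

theorem surjective_of_exact_of_le_moduleDepth [IsNoetherianRing R] {f : M →ₗ[R] N}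
    {g : N →ₗ[R] P} (hf : Function.Injective f) (hfg : Function.Exact f g)
    (hg : maximalIdeal R ≤ (Module.annihilator R (P ⧸ LinearMap.range g)).radical)
    (hM : 3 ≤ moduleDepth R M) (hN : 2 ≤ moduleDepth R N) (hP : 1 ≤ moduleDepth R P) :
    Function.Surjective g := by
  have hM2 := subsingleton_ext_residueField_of_natCast_le_moduleDepth (n := 3) hM 2 (by omega)
  have hN1 := subsingleton_ext_residueField_of_natCast_le_moduleDepth (n := 2) hN 1 (by omega)
  have hP0 := subsingleton_ext_residueField_of_natCast_le_moduleDepth (n := 1) hP 0 one_pos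
  have hrange := (IsShortExact.rangeRestrict hf hfg).subsingleton_ext_to_right _ 1 hN1 hM2
  have hcoker := subsingleton_of_subsingleton_ext_residueField hg
    ((IsShortExact.subtype_mkQ (LinearMap.range g)).subsingleton_ext_to_right _ 0 hP0 hrange)
  rwa [Submodule.Quotient.subsingleton_iff, LinearMap.range_eq_top] at hcoker

end Acyclicity

variable {M : Type*} [AddCommGroup M] [Module R M]

theorem span_pair_eq_top_of_isUnit {x y : M} (hxy : Submodule.span R {x, y} = ⊤) {a : R}
    (ha : IsUnit a) (b : R) : Submodule.span R {a • x + b • y, y} = ⊤ := by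
  have hy : y ∈ Submodule.span R {a • x + b • y, y} := Submodule.subset_span (by simp)
  have hv : a • x + b • y ∈ Submodule.span R {a • x + b • y, y} :=
    Submodule.subset_span (by simp)
  rw [← top_le_iff, ← hxy, Submodule.span_le]
  rintro _ (rfl | rfl)
  · rw [SetLike.mem_coe, ← Submodule.smul_mem_iff_of_isUnit _ ha]
    exact (Submodule.add_mem_iff_left _ (Submodule.smul_mem _ b hy)).mp hv
  · exact hy

variable [IsLocalRing R]

theorem span_pair_eq_top_of_notMem_sup {v w y : M} (hvy : Submodule.span R {v, y} = ⊤)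
    (hw : w ∉ Submodule.span R {v} ⊔ maximalIdeal R • (⊤ : Submodule R M)) :
    Submodule.span R {v, w} = ⊤ := by
  obtain ⟨a, b, rfl⟩ := Submodule.mem_span_pair.mp (hvy ▸ Submodule.mem_top (x := w))
  have hb : IsUnit b := by
    by_contra hb
    exact hw (Submodule.add_mem_sup (Submodule.smul_mem _ a (Submodule.mem_span_singleton_self v))
      (Submodule.smul_mem_smul ((mem_maximalIdeal b).mpr hb) Submodule.mem_top))
  rw [Set.pair_comm] at hvy ⊢
  rw [add_comm]
  exact span_pair_eq_top_of_isUnit hvy hb a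

theorem span_pair_eq_top_of_notMem {x y v w : M} (hxy : Submodule.span R {x, y} = ⊤)
    (hv : v ∉ maximalIdeal R • (⊤ : Submodule R M))
    (hw : w ∉ Submodule.span R {v} ⊔ maximalIdeal R • (⊤ : Submodule R M)) :
    Submodule.span R {v, w} = ⊤ := by
  obtain ⟨a, b, rfl⟩ := Submodule.mem_span_pair.mp (hxy ▸ Submodule.mem_top (x := v))
  by_cases ha : IsUnit a
  · exact span_pair_eq_top_of_notMem_sup (span_pair_eq_top_of_isUnit hxy ha b) hw
  by_cases hb : IsUnit b
  · rw [Set.pair_comm] at hxy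
    rw [add_comm] at hw ⊢
    exact span_pair_eq_top_of_notMem_sup (span_pair_eq_top_of_isUnit hxy hb a) hw
  exact (hv (add_mem (Submodule.smul_mem_smul ((mem_maximalIdeal a).mpr ha) Submodule.mem_top)
    (Submodule.smul_mem_smul ((mem_maximalIdeal b).mpr hb) Submodule.mem_top))).elim

variable {N : Type*} [AddCommGroup N] [Module R N]

theorem comap_sup_smul_top_ne_top [Module.Finite R M] {α : N →ₗ[R] M} {P : Submodule R M}
    (h : LinearMap.range α ⊔ P = ⊤) (hP : P ≠ ⊤) :
    (P ⊔ maximalIdeal R • ⊤).comap α ≠ ⊤ := by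
  intro htop
  refine hP (top_le_iff.mp (Submodule.le_of_le_smul_of_le_jacobson_bot Module.Finite.fg_top
    (maximalIdeal_le_jacobson ⊥) ?_))
  exact h.ge.trans (sup_le (LinearMap.range_le_iff_comap.mpr htop) le_sup_left)

theorem range_eq_top_or_exists_span_pair_eq_top {x y : M} (hxy : Submodule.span R {x, y} = ⊤)
    {α β : N →ₗ[R] M} (h : LinearMap.range α ⊔ LinearMap.range β = ⊤) :
    LinearMap.range α = ⊤ ∨ LinearMap.range β = ⊤ ∨ ∃ b, Submodule.span R {α b, β b} = ⊤ := by
  have : Module.Finite R M := ⟨hxy ▸ Submodule.fg_span (Set.toFinite _)⟩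
  by_contra! ⟨hα, hβ, hspan⟩
  have hcover : ((⊤ : Submodule R N) : Set N) ⊆
      ((LinearMap.range β ⊔ maximalIdeal R • ⊤).comap α : Submodule R N) ∪
        ((LinearMap.range α ⊔ maximalIdeal R • ⊤).comap β : Submodule R N) := by
    intro b _
    by_contra! hb
    obtain ⟨hαb, hβb⟩ := not_or.mp hb
    have hle : Submodule.span R {α b} ≤ LinearMap.range α :=
      (Submodule.span_singleton_le_iff_mem _ _).mpr ⟨b, rfl⟩
    exact hspan b (span_pair_eq_top_of_notMem hxy (fun h ↦ hαb (Submodule.mem_sup_right h))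
      fun h ↦ hβb (sup_le_sup_right hle (maximalIdeal R • ⊤) h))
  rcases AddSubgroupClass.subset_union.mp hcover with htop | htop
  · exact comap_sup_smul_top_ne_top h hβ (top_le_iff.mp htop)
  · exact comap_sup_smul_top_ne_top ((sup_comm _ _).trans h) hα (top_le_iff.mp htop)

end TwoGenerated

section ClassOfTwoGenerated

open IsLocalRing

variable {R : Type u} [CommRing R] [IsDomain R] [IsNoetherianRing R] [IsIntegrallyClosed R]

namespace DivisorClassGroup

variable {D : DivisorialIdeal R}

theorem isMaximalCohenMacaulayPoint_mk_iff :
    (mk D).IsMaximalCohenMacaulayPoint ↔ IsMaximalCohenMacaulay R D.toSubmodule :=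
  ⟨fun ⟨_, hmk, h⟩ ↦ h.congr (DivisorialIdeal.nonempty_linearEquiv_of_mk_eq hmk).some,
    fun h ↦ ⟨D, rfl, h⟩⟩

theorem mk_eq_zero_iff : mk D = 0 ↔ D ∈ (DivisorialIdeal.principal R).range :=
  Additive.ofMul.injective.eq_iff.trans (QuotientGroup.eq_one_iff D)

end DivisorClassGroup

namespace DivisorialIdeal

variable {D E F L L' L'' : DivisorialIdeal R} {f g : FractionRing R}

theorem mem_range_principal_of_forall_exists_mul_eq {x : FractionRing R} (hx : x ∈ D.1)
    (h : ∀ y ∈ (D * E).1, ∃ z ∈ E.1, x * z = y) : D ∈ (principal R).range := by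
  have hx0 : x ≠ 0 := by
    rintro rfl
    obtain ⟨y, hy, hy0⟩ := (D * E).exists_ne_zero
    obtain ⟨z, -, hz⟩ := h y hy
    exact hy0 (hz.symm.trans (zero_mul z))
  have hle : (principal R (Units.mk0 x hx0)).1 ≤ D.1 :=
    FractionalIdeal.spanSingleton_le_iff_mem.mpr hx
  refine ⟨Units.mk0 x hx0, mul_right_cancel (b := E)
    (Subtype.ext (le_antisymm (mul_mono hle E) fun y hy ↦ ?_))⟩
  obtain ⟨z, hz, rfl⟩ := h y hy
  exact mul_mem (self_mem_principal (Units.mk0 x hx0)) hz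

theorem mem_range_principal_of_mul_eq {b c : FractionRing R} (hb : b ∈ D.1) (hc : c ∈ (D⁻¹).1)
    {r : R} (hr : IsUnit r) (h : b * c = algebraMap R _ r) : D ∈ (principal R).range := by
  refine mem_range_principal_of_forall_exists_mul_eq (E := 1) hb fun y hy ↦ ?_
  obtain ⟨s, hs⟩ := mem_inv_iff.mp hc y (mul_one D ▸ hy)
  obtain ⟨t, ht⟩ := hr.exists_left_inv
  refine ⟨_, mem_one.mpr ⟨t * s, rfl⟩, ?_⟩
  have ht' : algebraMap R (FractionRing R) t * (b * c) = 1 := by rw [h, ← map_mul, ht, map_one]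
  rw [map_mul, hs]
  linear_combination y * ht'

theorem mem_range_principal_of_range_mulMap_eq_top (h : D * E = F) {x : FractionRing R}
    (hx : x ∈ E.1) (htop : LinearMap.range (mulMap h x hx) = ⊤) : E ∈ (principal R).range := by
  refine mem_range_principal_of_forall_exists_mul_eq (E := D) hx fun y hy ↦ ?_
  rw [mul_comm, h] at hy
  obtain ⟨z, hz⟩ := LinearMap.range_eq_top.mp htop ⟨y, hy⟩
  exact ⟨z, z.2, (mul_comm _ _).trans (congrArg Subtype.val hz)⟩

namespace IsInvGenerator

theorem span_pair_eq_top (h : IsInvGenerator D f) :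
    Submodule.span R {(⟨1, h.one_mem⟩ : D⁻¹.toSubmodule), ⟨f, h.mem⟩} = ⊤ := by
  refine top_le_iff.mp fun y _ ↦ Submodule.mem_span_pair.mpr ?_
  obtain ⟨a, b, hab⟩ := h.exists_eq y y.2
  refine ⟨a, b, Subtype.ext ?_⟩
  rw [hab, Submodule.coe_add, Submodule.coe_smul, Submodule.coe_smul, Algebra.smul_def,
    Algebra.smul_def, mul_one]

theorem mem_range_principal_of_span_pair_eq_top (h : IsInvGenerator D f) (hL'' : L * D⁻¹ = L'')
    {b : L.toSubmodule}
    (hb : Submodule.span R {mulMap hL'' 1 h.one_mem b, mulMap hL'' f h.mem b} = ⊤) :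
    L ∈ (principal R).range := by
  refine mem_range_principal_of_forall_exists_mul_eq (E := D⁻¹) b.2 fun y hy ↦ ?_
  rw [hL''] at hy
  obtain ⟨r, s, hrs⟩ := Submodule.mem_span_pair.mp (hb.ge (Submodule.mem_top (x := ⟨y, hy⟩)))
  refine ⟨r • 1 + s • f, D⁻¹.toSubmodule.add_mem (Submodule.smul_mem _ r h.one_mem)
    (Submodule.smul_mem _ s h.mem), .trans ?_ (congrArg Subtype.val hrs)⟩
  rw [Submodule.coe_add, Submodule.coe_smul, Submodule.coe_smul, mulMap_apply, mulMap_apply,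
    mul_add, mul_smul_comm, mul_smul_comm]

variable [IsLocalRing R] {d : ℕ}

theorem right_surjective (h : IsInvGenerator D f) (hR : IsGorensteinOfDim R d) (hd : 2 ≤ d)
    (hD : D.IsPuncturedLocallyPrincipal) (hL' : L * D = L') (hL'' : L * D⁻¹ = L'')
    (hdepth : 3 ≤ moduleDepth R L'.toSubmodule) : Function.Surjective (h.right hL'') := by
  have hL : ((2 : ℕ) : ℕ∞) ≤ moduleDepth R L.toSubmodule := two_le_moduleDepth hR hd L
  exact surjective_of_exact_of_le_moduleDepth (h.left_injective hL') (h.exact hL' hL'')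
    (h.maximalIdeal_le_radical_annihilator_quotient_range hL'' hD) hdepth
    (natCast_le_moduleDepth_prod hL hL) (one_le_two.trans (two_le_moduleDepth hR hd L''))

theorem mem_range_principal_of_three_le_moduleDepth (h : IsInvGenerator D f)
    (hR : IsGorensteinOfDim R d) (hd : 2 ≤ d) (hD : D.IsPuncturedLocallyPrincipal)
    (hdepth : 3 ≤ moduleDepth R (D * D).toSubmodule) : D ∈ (principal R).range := by
  have hpair {x y : FractionRing R} (hx : x ∈ D.1) (hy : y ∈ (D⁻¹).1) :
      ∃ r : R, algebraMap R (FractionRing R) r = x * y := by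
    rw [mul_comm]
    exact mem_inv_iff.mp hy x hx
  obtain ⟨⟨a, b⟩, hab⟩ := h.right_surjective hR hd hD rfl (mul_inv_cancel D) hdepth
    ⟨1, mem_one.mpr ⟨1, map_one _⟩⟩
  obtain ⟨r, hr⟩ := hpair a.2 h.one_mem
  obtain ⟨s, hs⟩ := hpair b.2 h.mem
  have hrs : r + s = 1 := by
    apply IsFractionRing.injective R (FractionRing R)
    rw [map_add, hr, hs, map_one, mul_one, ← h.right_apply (mul_inv_cancel D) (a, b), hab]
  rcases isUnit_or_isUnit_of_add_one hrs with hunit | hunit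
  · exact mem_range_principal_of_mul_eq a.2 h.one_mem hunit hr.symm
  · exact mem_range_principal_of_mul_eq b.2 h.mem hunit hs.symm

theorem mem_range_principal_or_of_three_le_moduleDepth (hDf : IsInvGenerator D f)
    (hEg : IsInvGenerator E g) (hR : IsGorensteinOfDim R d) (hd : 2 ≤ d)
    (hD : D.IsPuncturedLocallyPrincipal)
    (hdepth : 3 ≤ moduleDepth R (E * D ^ (-2 : ℤ))⁻¹.toSubmodule) :
    D ∈ (principal R).range ∨ E⁻¹ * D ∈ (principal R).range := by
  have hL' : E⁻¹ * D * D = (E * D ^ (-2 : ℤ))⁻¹ := by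
    rw [mul_inv, zpow_neg, inv_inv, mul_assoc, zpow_two]
  have hL'' : E⁻¹ * D * D⁻¹ = E⁻¹ := mul_inv_cancel_right _ _
  have hsup := LinearMap.range_eq_top.mpr (hDf.right_surjective hR hd hD hL' hL'' hdepth)
  rw [right, LinearMap.range_coprod] at hsup
  rcases range_eq_top_or_exists_span_pair_eq_top hEg.span_pair_eq_top hsup with h | h | ⟨b, h⟩
  · exact .inl (inv_mem_iff.mp (mem_range_principal_of_range_mulMap_eq_top hL'' _ h))
  · exact .inl (inv_mem_iff.mp (mem_range_principal_of_range_mulMap_eq_top hL'' _ h))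
  · exact .inr (hDf.mem_range_principal_of_span_pair_eq_top hL'' h)

theorem mem_range_principal (hDf : IsInvGenerator D f) (hEg : IsInvGenerator E g)
    (hR : IsGorensteinOfDim R d) (hd : 3 ≤ d) (hD : D.IsPuncturedLocallyPrincipal)
    (hE : HasNoHigherExt R E.toSubmodule R)
    (hpos : IsMaximalCohenMacaulay R (E * D ^ (2 : ℤ)).toSubmodule)
    (hneg : IsMaximalCohenMacaulay R (E * D ^ (-2 : ℤ)).toSubmodule) :
    D ∈ (principal R).range := by
  have hd' : (3 : ℕ∞) ≤ d := by exact_mod_cast hd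
  have hd2 : 2 ≤ d := by omega
  have hdepth := hd'.trans (natCast_le_moduleDepth_inv hR
    (hR.hasNoHigherExt_of_natCast_le_moduleDepth (hneg.natCast_le_moduleDepth hR.ringKrullDim_eq)))
  refine (hDf.mem_range_principal_or_of_three_le_moduleDepth hEg hR hd2 hD hdepth).elim id
    fun hED ↦ hDf.mem_range_principal_of_three_le_moduleDepth hR hd2 hD ?_
  have hone := hDf.isMaximalCohenMacaulay_mul_zpow hR hd2 hD hE hpos (i := 1) (.inl (by omega))
  have hmk : DivisorClassGroup.mk (E * D ^ (1 : ℤ)) = DivisorClassGroup.mk (D * D) := by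
    refine congrArg Additive.ofMul (QuotientGroup.eq.mpr ?_)
    rwa [zpow_one, mul_inv, mul_assoc, inv_mul_cancel_left]
  obtain ⟨e⟩ := nonempty_linearEquiv_of_mk_eq hmk
  exact hd'.trans ((hone.congr e).natCast_le_moduleDepth hR.ringKrullDim_eq)

end IsInvGenerator

end DivisorialIdeal

end ClassOfTwoGenerated

theorem mainTheorem8 (R : Type u) [CommRing R] [IsDomain R] [IsLocalRing R] [IsNoetherianRing R]
    [IsIntegrallyClosed R] (hR : IsGorensteinLocalRing R) (hdim : 3 ≤ ringKrullDim R)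
    (I J : Ideal R) (hI : I.IsGorenstein) (hJ : J.IsGorenstein)
    (hI1 : I.height = 1) (hJ1 : J.height = 1)
    (hfree : IsLocallyFreeOnPuncturedSpectrum R I)
    (cI cJ : DivisorClassGroup R)
    (hcI : cI = DivisorClassGroup.ofIdeal I (Ideal.ne_bot_of_height_one hI1))
    (hcJ : cJ = DivisorClassGroup.ofIdeal J (Ideal.ne_bot_of_height_one hJ1)) :
    ((∀ n : ℤ, 0 ≤ n → (cJ + n • cI).IsMaximalCohenMacaulayPoint →
        ∀ i : ℤ, 0 ≤ i → i ≤ n → (cJ + i • cI).IsMaximalCohenMacaulayPoint) ∧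
      (∀ n : ℤ, n ≤ 0 → (cJ + n • cI).IsMaximalCohenMacaulayPoint →
        ∀ i : ℤ, n ≤ i → i ≤ 0 → (cJ + i • cI).IsMaximalCohenMacaulayPoint)) ∧
    ((cJ + (2 : ℤ) • cI).IsMaximalCohenMacaulayPoint ∧
        (cJ - (2 : ℤ) • cI).IsMaximalCohenMacaulayPoint → cI = 0 ∧ I.IsPrincipal) := by
  obtain ⟨d, hR⟩ := hR.exists_isGorensteinOfDim
  have hd : 3 ≤ d := by
    rw [hR.ringKrullDim_eq] at hdim
    exact_mod_cast hdim
  have hI0 := Ideal.ne_bot_of_height_one hI1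
  have hJ0 := Ideal.ne_bot_of_height_one hJ1
  let D := DivisorialIdeal.ofIdeal I hI0
  let E := DivisorialIdeal.ofIdeal J hJ0
  obtain ⟨f, hf⟩ := DivisorialIdeal.exists_isInvGenerator_ofIdeal hR hI0 hI hI1
  obtain ⟨g, hg⟩ := DivisorialIdeal.exists_isInvGenerator_ofIdeal hR hJ0 hJ hJ1
  have hD : D.IsPuncturedLocallyPrincipal := fun p _ hp ↦
    have := hfree p hp
    DivisorialIdeal.ofIdeal_mem_locallyPrincipal hI0 p
  have hE := DivisorialIdeal.hasNoHigherExt_ofIdeal hR hJ0 hJ hJ1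
  have hpoint (n : ℤ) : (cJ + n • cI).IsMaximalCohenMacaulayPoint ↔
      IsMaximalCohenMacaulay R (E * D ^ n).toSubmodule := by
    rw [hcI, hcJ]
    exact DivisorClassGroup.isMaximalCohenMacaulayPoint_mk_iff
  simp only [sub_eq_add_neg, ← neg_smul, hpoint]
  refine ⟨⟨fun n _ hn i h0i hin ↦ ?_, fun n _ hn i hni hi0 ↦ ?_⟩, fun ⟨hpos, hneg⟩ ↦ ?_⟩
  · exact hf.isMaximalCohenMacaulay_mul_zpow hR (by omega) hD hE hn (.inl ⟨h0i, hin⟩)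
  · exact hf.isMaximalCohenMacaulay_mul_zpow hR (by omega) hD hE hn (.inr ⟨hni, hi0⟩)
  · have hprincipal := hf.mem_range_principal hg hR hd hD hE hpos hneg
    exact ⟨hcI.trans (DivisorClassGroup.mk_eq_zero_iff.mpr hprincipal),
      DivisorialIdeal.isPrincipal_of_ofIdeal_mem_range_principal hR hI0 hI hI1 hprincipal⟩
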